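/- **Definitions.** Let $\mathcal M=(M,\mathcal A)$ be a smooth supermanifold of dimension $p|q$: $M$ is a Hausdorff topological space and $\mathcal A$ is a sheaf of associative, unital, supercommutative $\mathbb R$-algebras on $M$ such that every point of $M$ has an open neighbourhood $U$ carrying local coordinates $(x,\xi)=(x^1,\dots,x^p,\xi^1,\dots,\xi^q)$, that is, an isomorphism of $(U,\mathcal A|_U)$ with a superdomain $(\mathfrak U,C^\infty_{\mathfrak U}[\xi^1,\dots,\xi^q])$, where $\mathfrak U\subset\mathbb R^p$ is open and the $\xi^a$ are anticommuting odd generators. For $U\subset M$ open and $f\in\mathcal A(U)$ write $m_f$ for multiplication $g\mapsto fg$, and let $[-,-]$ be the supercommutator of $\mathbb R$-linear endomorphisms of the $\mathbb Z/2$-graded space $\mathcal A(U)$. Put $\mathcal D^{-1}(U)=\{0\}$ and, for $k\in\mathbb N=\{0,1,2,\dots\}$, $$\mathcal D^k(U)=\{D\in\operatorname{End}_{\mathbb R}(\mathcal A(U)) : [D,m_f]\in\mathcal D^{k-1}(U)\ \text{for all } f\in\mathcal A(U)\},$$ an $\mathcal A(U)$-module under $(fD)(g)=f\,D(g)$, whose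 elements are the $k$-th order superdifferential operators on $U$. **Proposition.** Let $k\in\mathbb N$. 1. For all open $V\subset U\subset M$ and every $D\in\mathcal D^k(U)$ there is a unique $D|_V\in\mathcal D^k(V)$ such that $(Df)|_V=D|_V(f|_V)$ for all $f\in\mathcal A(U)$. 2. With these restrictions, $U\mapsto\mathcal D^k(U)$ is a locally free sheaf of $\mathcal A$-modules. 3. For any local coordinates $(x,\xi)$ on an open set $U\subset M$, the operators $$\partial_x^\alpha\partial_\xi^\beta:=\partial_{x^1}^{\alpha^1}\cdots\partial_{x^p}^{\alpha^p}\,\partial_{\xi^q}^{\beta^q}\cdots\partial_{\xi^1}^{\beta^1},\qquad \alpha\in\mathbb N^p,\ \beta\in\{0,1\}^q,\ |\alpha|+|\beta|\le k,$$ belong to $\mathcal D^k(U)$ and form a basis of $\mathcal D^k|_U$: for every open $V\subset U$ their restrictions to $V$ form a basis of the $\mathcal A(V)$-module $\mathcal D^k(V)$. -/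

import Mathlib

open CategoryTheory Opposite TopologicalSpace
open scoped Manifold ContDiff TensorProduct

universe u

noncomputable section

namespace Supergeometry

/-! ### Superdomains -/

/-- Smooth real functions on an open subset `W` of `ℝ^p`. -/
abbrev SmoothFn {p : ℕ} (W : Opens (EuclideanSpace ℝ (Fin p))) : Type :=
  C^∞⟮𝓘(ℝ, EuclideanSpace ℝ (Fin p)), W; 𝓘(ℝ, ℝ), ℝ⟯

/-- The Grassmann algebra over `ℝ` on `q` anticommuting generators `ξ^1, …, ξ^q`. -/
abbrev Grassmann (q : ℕ) : Type := ExteriorAlgebra ℝ (Fin q → ℝ)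

/-- `C^∞(W)[ξ^1, …, ξ^q]`, the algebra of superfunctions on the superdomain over `W`. -/
abbrev SuperFn {p : ℕ} (q : ℕ) (W : Opens (EuclideanSpace ℝ (Fin p))) : Type :=
  SmoothFn W ⊗[ℝ] Grassmann q

/-- Even (`i = 0`) and odd (`i = 1`) superfunctions on a superdomain: the smooth coefficients are
even and each `ξ^a` is odd. -/
def SuperFn.parity {p : ℕ} (q : ℕ) (W : Opens (EuclideanSpace ℝ (Fin p))) (i : ZMod 2) :
    Submodule ℝ (SuperFn q W) :=
  ((CliffordAlgebra.evenOdd (0 : QuadraticForm ℝ (Fin q → ℝ)) i).baseChange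
    (SmoothFn W)).restrictScalars ℝ

/-- Restriction of smooth functions to a smaller open set. -/
def SmoothFn.res {p : ℕ} {W W' : Opens (EuclideanSpace ℝ (Fin p))} (h : W' ≤ W) :
    SmoothFn W →ₐ[ℝ] SmoothFn W' :=
  { ContMDiffMap.restrictRingHom 𝓘(ℝ, EuclideanSpace ℝ (Fin p)) 𝓘(ℝ, ℝ) ℝ h with
    commutes' := fun _ => rfl }

/-- Restriction of superfunctions of a superdomain, coefficient by coefficient. -/
def SuperFn.res {p : ℕ} (q : ℕ) {W W' : Opens (EuclideanSpace ℝ (Fin p))} (h : W' ≤ W) :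
    SuperFn q W →ₐ[ℝ] SuperFn q W' :=
  Algebra.TensorProduct.map (SmoothFn.res h) (AlgHom.id ℝ (Grassmann q))

/-- Extension of a smooth function on `W` by zero; only its germs at points of `W` matter. -/
def SmoothFn.ext0 {p : ℕ} {W : Opens (EuclideanSpace ℝ (Fin p))} (f : SmoothFn W) :
    EuclideanSpace ℝ (Fin p) → ℝ :=
  Function.extend Subtype.val f 0

theorem SmoothFn.contDiffAt_ext0 {p : ℕ} {W : Opens (EuclideanSpace ℝ (Fin p))}
    (f : SmoothFn W) (x : W) : ContDiffAt ℝ ∞ f.ext0 x := by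
  rw [← contMDiffAt_iff_contDiffAt, ← contMDiffAt_subtype_iff]
  have : (fun y : W => f.ext0 y) = f := by
    funext y
    exact Subtype.val_injective.extend_apply _ _ _
  rw [this]
  exact f.contMDiff.contMDiffAt

/-- The partial derivative `∂/∂x^i` of smooth functions on an open subset of `ℝ^p`. -/
def SmoothFn.partialX {p : ℕ} (W : Opens (EuclideanSpace ℝ (Fin p))) (i : Fin p) :
    SmoothFn W →ₗ[ℝ] SmoothFn W where
  toFun f := ⟨fun x => fderiv ℝ f.ext0 x (EuclideanSpace.single i 1), by
    intro x
    refine (contMDiffAt_subtype_iff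
      (f := fun y => fderiv ℝ f.ext0 y (EuclideanSpace.single i 1))).2 ?_
    rw [contMDiffAt_iff_contDiffAt]
    exact ((f.contDiffAt_ext0 x).fderiv_right (m := ∞) (by simp)).clm_apply contDiffAt_const⟩
  map_add' f g := by
    ext x
    have h : (f + g).ext0 = f.ext0 + g.ext0 := by
      unfold SmoothFn.ext0
      rw [← Function.extend_add]
      simp
    change fderiv ℝ (f + g).ext0 x _ = fderiv ℝ f.ext0 x _ + fderiv ℝ g.ext0 x _
    rw [h, fderiv_add ((f.contDiffAt_ext0 x).differentiableAt (by simp))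
      ((g.contDiffAt_ext0 x).differentiableAt (by simp))]
    rfl
  map_smul' c f := by
    ext x
    have h : (c • f).ext0 = c • f.ext0 := by
      unfold SmoothFn.ext0
      rw [← Function.extend_smul]
      simp
    change fderiv ℝ (c • f).ext0 x _ = c • fderiv ℝ f.ext0 x _
    rw [h, fderiv_const_smul ((f.contDiffAt_ext0 x).differentiableAt (by simp))]
    rfl

/-- The even partial derivative `∂/∂x^i` on a superdomain: it acts on the coefficients. -/
def SuperFn.partialX {p : ℕ} (q : ℕ) (W : Opens (EuclideanSpace ℝ (Fin p))) (i : Fin p) :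
    Module.End ℝ (SuperFn q W) :=
  (SmoothFn.partialX W i).rTensor (Grassmann q)

/-- The odd partial derivative `∂/∂ξ^a` on a superdomain: the odd derivation from the left that
kills the smooth coefficients and sends `ξ^b` to `δ_{ab}`. -/
def SuperFn.partialXi {p : ℕ} (q : ℕ) (W : Opens (EuclideanSpace ℝ (Fin p))) (a : Fin q) :
    Module.End ℝ (SuperFn q W) :=
  (CliffordAlgebra.contractLeft (Q := (0 : QuadraticForm ℝ (Fin q → ℝ)))
    (LinearMap.proj a)).lTensor (SmoothFn W)

/-- Pairs `(α, β)` with `α ∈ ℕ^p`, `β ∈ {0,1}^q` and `|α| + |β| ≤ k`. -/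
abbrev MultiIndex (p q k : ℕ) : Type :=
  {γ : (Fin p → ℕ) × (Fin q → Fin 2) // ∑ i, γ.1 i + ∑ a, (γ.2 a : ℕ) ≤ k}

/-- The operator
`∂_{x^1}^{α^1} ⋯ ∂_{x^p}^{α^p} ∂_{ξ^q}^{β^q} ⋯ ∂_{ξ^1}^{β^1}` on a superdomain. -/
def SuperFn.partialMulti {p : ℕ} (q : ℕ) (W : Opens (EuclideanSpace ℝ (Fin p)))
    (α : Fin p → ℕ) (β : Fin q → Fin 2) : Module.End ℝ (SuperFn q W) :=
  (List.ofFn fun i => SuperFn.partialX q W i ^ α i).prod *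
    (List.ofFn fun a => SuperFn.partialXi q W a ^ (β a : ℕ)).reverse.prod

/-! ### The supercommutator of endomorphisms -/

section Supercommutator

variable {A : Type u} [Ring A] [Algebra ℝ A] (P : ZMod 2 → Submodule ℝ A) [GradedAlgebra P]

/-- The component of parity `i` of an endomorphism of a `ℤ/2`-graded algebra `A`, i.e. its part
that sends `A_j` to `A_{i+j}`. -/
def endComponent (i : ZMod 2) (D : Module.End ℝ A) : Module.End ℝ A :=
  ∑ j : ZMod 2, GradedAlgebra.proj P (i + j) * D * GradedAlgebra.proj P j

/-- The supercommutator, `[D, E] = D E - (-1)^{|D||E|} E D` for homogeneous `D` and `E`, extended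
bilinearly. -/
def supercommutator (D E : Module.End ℝ A) : Module.End ℝ A :=
  D * E - ∑ i : ZMod 2, ∑ j : ZMod 2,
    (-1 : ℝ) ^ (i.val * j.val) • (endComponent P j E * endComponent P i D)

theorem endComponent_add (i : ZMod 2) (D D' : Module.End ℝ A) :
    endComponent P i (D + D') = endComponent P i D + endComponent P i D' := by
  simp [endComponent, mul_add, add_mul, Finset.sum_add_distrib]

theorem supercommutator_add_left (D D' E : Module.End ℝ A) :
    supercommutator P (D + D') E = supercommutator P D E + supercommutator P D' E := by
  simp only [supercommutator, endComponent_add, mul_add, add_mul, smul_add,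
    Finset.sum_add_distrib]
  abel

theorem supercommutator_add_right (D E E' : Module.End ℝ A) :
    supercommutator P D (E + E') = supercommutator P D E + supercommutator P D E' := by
  simp only [supercommutator, endComponent_add, mul_add, add_mul, smul_add,
    Finset.sum_add_distrib]
  abel

theorem supercommutator_zero_left (E : Module.End ℝ A) : supercommutator P 0 E = 0 := by
  simp [supercommutator, endComponent]

theorem endComponent_smul_of_mem (i a : ZMod 2) (g : A) (hg : g ∈ P a) (D : Module.End ℝ A) :
    endComponent P (a + i) (g • D) = g • endComponent P i D := by
  ext y
  simp only [endComponent, LinearMap.sum_apply, Module.End.mul_apply, LinearMap.smul_apply,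
    GradedAlgebra.proj_apply, smul_eq_mul, Finset.mul_sum]
  refine Finset.sum_congr rfl fun j _ => ?_
  rw [add_assoc, DirectSum.coe_decompose_mul_add_of_left_mem P hg]

theorem zmod_two_cases (a : ZMod 2) : a = 0 ∨ a = 1 := by
  revert a
  decide

theorem sum_proj (y : A) : ∑ j : ZMod 2, GradedAlgebra.proj P j y = y := by
  classical
  refine Eq.trans (Finset.sum_subset (Finset.subset_univ _) ?_).symm
    (DirectSum.sum_support_decompose P y)
  intro j _ hj
  simpa using hj

theorem endComponent_mulLeft_of_mem (i j : ZMod 2) (f : A) (hf : f ∈ P j) :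
    endComponent P i (LinearMap.mulLeft ℝ f) = if i = j then LinearMap.mulLeft ℝ f else 0 := by
  ext y
  have hmem : ∀ l, f * GradedAlgebra.proj P l y ∈ P (j + l) := fun l =>
    SetLike.mul_mem_graded hf (by simp)
  simp only [endComponent, LinearMap.sum_apply, Module.End.mul_apply, LinearMap.mulLeft_apply]
  split_ifs with h
  · subst h
    rw [Finset.sum_congr rfl (fun l _ => (GradedAlgebra.proj_apply P (i + l) _).trans
      (DirectSum.decompose_of_mem_same P (hmem l))), ← Finset.mul_sum, sum_proj]
    rfl
  · refine Finset.sum_eq_zero fun l _ => ?_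
    rw [GradedAlgebra.proj_apply, DirectSum.decompose_of_mem_ne P (hmem l)]
    exact fun e => h (add_right_cancel e).symm

theorem supercommutator_mulLeft_of_mem (j : ZMod 2) (f : A) (hf : f ∈ P j)
    (D : Module.End ℝ A) :
    supercommutator P D (LinearMap.mulLeft ℝ f) = D * LinearMap.mulLeft ℝ f -
      ∑ i : ZMod 2, (-1 : ℝ) ^ (i.val * j.val) • (f • endComponent P i D) := by
  unfold supercommutator
  congr 1
  refine Finset.sum_congr rfl fun i _ => ?_
  rw [Finset.sum_eq_single j]
  · rw [endComponent_mulLeft_of_mem P j j f hf, if_pos rfl]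
    rfl
  · intro l _ hl
    rw [endComponent_mulLeft_of_mem P l j f hf, if_neg hl, zero_mul, smul_zero]
  · simp

theorem supercommutator_smul (hP : ∀ (i j : ZMod 2) (f g : A), f ∈ P i → g ∈ P j →
    f * g = (-1 : ℝ) ^ (i.val * j.val) • (g * f)) (g f : A) (D : Module.End ℝ A) :
    supercommutator P (g • D) (LinearMap.mulLeft ℝ f) =
      g • supercommutator P D (LinearMap.mulLeft ℝ f) := by
  have hom : ∀ (a j : ZMod 2) (g f : A), g ∈ P a → f ∈ P j →
      supercommutator P (g • D) (LinearMap.mulLeft ℝ f) =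
        g • supercommutator P D (LinearMap.mulLeft ℝ f) := by
    intro a j g f hg hf
    rw [supercommutator_mulLeft_of_mem P j f hf, supercommutator_mulLeft_of_mem P j f hf,
      smul_sub, Finset.smul_sum]
    congr 1
    rw [← Equiv.sum_comp (Equiv.addLeft a)]
    refine Finset.sum_congr rfl fun i _ => ?_
    rw [Equiv.coe_addLeft, endComponent_smul_of_mem P i a g hg, smul_comm g, smul_smul, smul_smul,
      hP j a f g hf hg, smul_assoc, smul_smul]
    congr 1
    have h0 : (0 : ZMod 2).val = 0 := rfl
    have h1 : (1 : ZMod 2).val = 1 := rfl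
    have h2 : (1 : ZMod 2) + 1 = 0 := rfl
    rcases zmod_two_cases a with rfl | rfl <;> rcases zmod_two_cases j with rfl | rfl <;>
      rcases zmod_two_cases i with rfl | rfl <;> simp [h0, h1, h2]
  induction g using DirectSum.Decomposition.inductionOn P with
  | zero => simp [supercommutator_zero_left]
  | add g g' h h' => rw [add_smul, supercommutator_add_left, h, h', add_smul]
  | homogeneous g =>
    rename_i a
    induction f using DirectSum.Decomposition.inductionOn P with
    | zero =>
      exact hom a 0 g 0 g.2 (zero_mem _)
    | add f f' h h' =>
      have e : LinearMap.mulLeft ℝ (f + f') = LinearMap.mulLeft ℝ f + LinearMap.mulLeft ℝ f' := by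
        ext y; simp [add_mul]
      rw [e, supercommutator_add_right, h, h', supercommutator_add_right, smul_add]
    | homogeneous f => exact hom _ _ g f g.2 f.2

/-- The operators `D` with `[D, A] ⊆ N`, where `A` acts on itself by left multiplication. -/
def commutatorInto (hP : ∀ (i j : ZMod 2) (f g : A), f ∈ P i → g ∈ P j →
    f * g = (-1 : ℝ) ^ (i.val * j.val) • (g * f)) (N : Submodule A (Module.End ℝ A)) :
    Submodule A (Module.End ℝ A) where
  carrier := {D | ∀ f : A, supercommutator P D (LinearMap.mulLeft ℝ f) ∈ N}
  add_mem' h h' f := by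
    rw [supercommutator_add_left]
    exact N.add_mem (h f) (h' f)
  zero_mem' f := by
    rw [supercommutator_zero_left]
    exact N.zero_mem
  smul_mem' g D h f := by
    rw [supercommutator_smul P hP]
    exact N.smul_mem g (h f)

/-- The `A`-module of differential operators of order at most `k` on the supercommutative
algebra `A`: the `ℝ`-linear endomorphisms `D` such that `[D, A]` consists of operators of order
at most `k - 1`, where only `0` has order at most `-1`. -/
def diffOps (hP : ∀ (i j : ZMod 2) (f g : A), f ∈ P i → g ∈ P j →
    f * g = (-1 : ℝ) ^ (i.val * j.val) • (g * f)) : ℕ → Submodule A (Module.End ℝ A)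
  | 0 => commutatorInto P hP ⊥
  | k + 1 => commutatorInto P hP (diffOps hP k)

end Supercommutator

/-! ### Sheaves of supercommutative algebras -/

/-- A sheaf of associative, unital, supercommutative real algebras on `M`. -/
structure SuperSheaf (M : TopCat.{u}) where
  /-- the underlying sheaf of real algebras -/
  sheaf : TopCat.Sheaf (AlgCat.{u} ℝ) M
  /-- the even and the odd sections -/
  parity (U : Opens M) : ZMod 2 → Submodule ℝ (sheaf.obj.obj (op U))
  graded (U : Opens M) : GradedAlgebra (parity U)
  supercomm (U : Opens M) (i j : ZMod 2) (f g : sheaf.obj.obj (op U))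
    (hf : f ∈ parity U i) (hg : g ∈ parity U j) :
    f * g = (-1 : ℝ) ^ (i.val * j.val) • (g * f)
  map_mem {U V : Opens M} (h : V ≤ U) (i : ZMod 2) (f : sheaf.obj.obj (op U))
    (hf : f ∈ parity U i) : (sheaf.obj.map (homOfLE h).op).hom f ∈ parity V i

attribute [instance] SuperSheaf.graded

namespace SuperSheaf

variable {M : TopCat.{u}} (𝒜 : SuperSheaf M)

/-- The superalgebra `𝒜(U)`. -/
abbrev Sections (U : Opens M) : Type u := 𝒜.sheaf.obj.obj (op U)

/-- The restriction `𝒜(U) → 𝒜(V)`. -/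
def res {U V : Opens M} (h : V ≤ U) : 𝒜.Sections U →ₐ[ℝ] 𝒜.Sections V :=
  (𝒜.sheaf.obj.map (homOfLE h).op).hom

/-- The structure sheaf as a sheaf of rings. -/
abbrev ringSheaf : TopCat.Sheaf RingCat.{u} M :=
  (sheafCompose (Opens.grothendieckTopology M) (forget₂ (AlgCat.{u} ℝ) RingCat.{u})).obj 𝒜.sheaf

/-- The `𝒜(U)`-module `𝒟^k(U)` of `k`-th order superdifferential operators on `𝒜(U)`. -/
def diffOp (k : ℕ) (U : Opens M) :
    Submodule (𝒜.Sections U) (Module.End ℝ (𝒜.Sections U)) :=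
  diffOps (𝒜.parity U) (𝒜.supercomm U) k

/-- `D'` on `𝒜(V)` is a restriction of `D` on `𝒜(U)`: `(D f)|_V = D' (f|_V)` for `f ∈ 𝒜(U)`. -/
def IsRestriction {U V : Opens M} (h : V ≤ U) (D : Module.End ℝ (𝒜.Sections U))
    (D' : Module.End ℝ (𝒜.Sections V)) : Prop :=
  ∀ f : 𝒜.Sections U, 𝒜.res h (D f) = D' (𝒜.res h f)

/-- The sections over `U` of a sheaf of `𝒜`-modules, as an `𝒜(U)`-module. -/
abbrev ModSections (ℱ : SheafOfModules.{u} 𝒜.ringSheaf) (U : Opens M) : Type u :=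
  ℱ.val.obj (op U)

instance (ℱ : SheafOfModules.{u} 𝒜.ringSheaf) (U : Opens M) :
    Module (𝒜.Sections U) (𝒜.ModSections ℱ U) :=
  inferInstanceAs (Module (𝒜.ringSheaf.obj.obj (op U)) (ℱ.val.obj (op U)))

/-- Restriction of sections of a sheaf of `𝒜`-modules. -/
def modRes (ℱ : SheafOfModules.{u} 𝒜.ringSheaf) {U V : Opens M} (h : V ≤ U)
    (s : 𝒜.ModSections ℱ U) : 𝒜.ModSections ℱ V :=
  (ℱ.val.map (homOfLE h).op).hom s

/-- The sections `e i` over `U` form a basis of `ℱ|_U`: for each open `V ⊆ U` their restrictions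
form a basis of the `𝒜(V)`-module `ℱ(V)`. -/
def IsBasisOn (ℱ : SheafOfModules.{u} 𝒜.ringSheaf) (U : Opens M) {I : Type}
    (e : I → 𝒜.ModSections ℱ U) : Prop :=
  ∀ (V : Opens M) (h : V ≤ U), ∃ b : Module.Basis I (𝒜.Sections V) (𝒜.ModSections ℱ V),
    ∀ i, b i = 𝒜.modRes ℱ h (e i)

end SuperSheaf

/-! ### Supermanifolds -/

/-- The image of `V` in `ℝ^p` under a homeomorphism whose source contains `V`. -/
def bodyImage {M : TopCat.{u}} {p : ℕ} (φ : OpenPartialHomeomorph M (EuclideanSpace ℝ (Fin p)))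
    (V : Opens M) : Opens (EuclideanSpace ℝ (Fin p)) :=
  ⟨φ.target ∩ φ.symm ⁻¹' V, φ.isOpen_inter_preimage_symm V.isOpen⟩

theorem bodyImage_mono {M : TopCat.{u}} {p : ℕ}
    (φ : OpenPartialHomeomorph M (EuclideanSpace ℝ (Fin p))) {V V' : Opens M} (h : V' ≤ V) :
    bodyImage φ V' ≤ bodyImage φ V :=
  fun _ hx => ⟨hx.1, h hx.2⟩

/-- A system of local coordinates of dimension `p|q` on the open set `U`: an isomorphism of
`(U, 𝒜|_U)` onto the superdomain over an open subset of `ℝ^p`. -/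
structure SuperChart {M : TopCat.{u}} (𝒜 : SuperSheaf M) (p q : ℕ) (U : Opens M) where
  /-- the underlying homeomorphism of `U` onto an open subset of `ℝ^p` -/
  toBody : OpenPartialHomeomorph M (EuclideanSpace ℝ (Fin p))
  source_eq : toBody.source = U
  /-- the isomorphism of `𝒜(V)` with the superfunctions over the image of `V` -/
  iso (V : Opens M) (h : V ≤ U) : 𝒜.Sections V ≃ₐ[ℝ] SuperFn q (bodyImage toBody V)
  iso_parity (V : Opens M) (h : V ≤ U) (i : ZMod 2) (f : 𝒜.Sections V)
    (hf : f ∈ 𝒜.parity V i) : iso V h f ∈ SuperFn.parity q (bodyImage toBody V) i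
  iso_res (V V' : Opens M) (h : V ≤ U) (h' : V' ≤ V) (f : 𝒜.Sections V) :
    iso V' (h'.trans h) (𝒜.res h' f) = SuperFn.res q (bodyImage_mono toBody h') (iso V h f)

/-- The operator
`∂_{x^1}^{α^1} ⋯ ∂_{x^p}^{α^p} ∂_{ξ^q}^{β^q} ⋯ ∂_{ξ^1}^{β^1}` on `𝒜(U)` in local
coordinates `(x, ξ)` on `U`. -/
def SuperChart.partialMulti {M : TopCat.{u}} {𝒜 : SuperSheaf M} {p q : ℕ} {U : Opens M}
    (c : SuperChart 𝒜 p q U) (α : Fin p → ℕ) (β : Fin q → Fin 2) :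
    Module.End ℝ (𝒜.Sections U) :=
  (c.iso U le_rfl).symm.toLinearMap ∘ₗ
    SuperFn.partialMulti q (bodyImage c.toBody U) α β ∘ₗ (c.iso U le_rfl).toLinearMap

/-- `(M, 𝒜)` is a smooth supermanifold of dimension `p|q`. -/
structure IsSupermanifold {M : TopCat.{u}} (𝒜 : SuperSheaf M) (p q : ℕ) : Prop where
  t2 : T2Space M
  exists_chart (m : M) : ∃ U : Opens M, m ∈ U ∧ Nonempty (SuperChart 𝒜 p q U)

end Supergeometry

end

/-!
# Superdifferential operators on a supermanifold

The parity involution `σ` of a supercommutative algebra (`f₀ + f₁ ↦ f₀ - f₁`) rewrites the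
supercommutator of an operator `D` with multiplication by a homogeneous `f` as `D f - f D` for even
`f` and `D f - f (σ D σ)` for odd `f`. So the operators of order `≤ k` are described by a recursion
in which only homogeneous `f` occur (`IsSuperDiffOp`, `mem_diffOps_iff`); orders there are strict
bounds, so that the recursion starts at the zero operator.

*Restriction and gluing.* On a supermanifold there are even bump functions `χ`
(`IsSupermanifold.exists_bump`). Superdifferential operators are local
(`IsSupermanifold.isLocalOp`): if `f` vanishes on `W` and `χ` is supported in `W`, then `χ f = 0`,
so `χ D f = -[D, χ] f`, and `[D, χ]` has smaller order. Since every germ of a section over `V`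
extends to `U ⊇ V` (`IsSupermanifold.exists_extension`), a local operator on `𝒜(U)` restricts
uniquely to `𝒜(V)`; the order of an operator is a local property, whence
`IsSupermanifold.existsUnique_restriction` and `IsSupermanifold.exists_glue_diffOp`.

*The basis.* On a superdomain, the operators `∂_x^α ∂_ξ^β` act on the monomials `x^α' ξ^β'`
triangularly with respect to the degree, with nonzero constants on the diagonal. By
`exists_basis_of_triangular`, they form a basis of the operators of order `≤ k` as soon as such an
operator `D` vanishes when it kills the monomials of degree `≤ k`. This is
`SuperFn.eq_zero_of_monomial`: such a `D` kills all polynomials, by induction on the degree. Given a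
point `y`, Hadamard's lemma (`SmoothFn.exists_hadamard`) writes any superfunction as a polynomial
plus an element of a high power of the ideal of superfunctions whose body vanishes at `y`. The
operator `D` lowers the exponent of this power by at most `k`, and all coefficients of an element of
the `(q + 1)`-st power vanish at `y`, because a product of `q + 1` of the `ξ^a` is zero.

*Local freeness.* Sections that restrict to bases over all smaller open sets define an isomorphism
from a free sheaf; its inverse is given by coordinates (`isIso_freeHomEquiv_symm_of_basis`).
-/

noncomputable section

namespace Supergeometry

/-! ### Differential operators relative to a parity involution -/

section Involution

variable {A : Type*} [Ring A] [Algebra ℝ A]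

/-- The conjugate `σ D σ` of an endomorphism by the parity involution `σ`; it is `D` for even `D`
and `-D` for odd `D`. -/
def twist (σ : A →ₐ[ℝ] A) (D : Module.End ℝ A) : Module.End ℝ A :=
  σ.toLinearMap * D * σ.toLinearMap

/-- `σ` is the parity involution of a supercommutative algebra: the even elements are the fixed
points of `σ`, the odd ones its `-1`-eigenvectors. -/
structure IsSuperInvolution (σ : A →ₐ[ℝ] A) : Prop where
  invol : ∀ f, σ (σ f) = f
  even_comm : ∀ f g, σ f = f → f * g = g * f
  odd_comm : ∀ f g, σ f = -f → f * g = σ g * f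

/-- Superdifferential operators of order `< n`, with parities encoded by the involution `σ`: for
odd `f` the supercommutator of `D` with multiplication by `f` is `D f - f (σ D σ)`. -/
def IsSuperDiffOp (σ : A →ₐ[ℝ] A) : ℕ → Module.End ℝ A → Prop
  | 0, D => D = 0
  | n + 1, D =>
    (∀ f, σ f = f → IsSuperDiffOp σ n (D * LinearMap.mulLeft ℝ f - LinearMap.mulLeft ℝ f * D)) ∧
    (∀ f, σ f = -f →
      IsSuperDiffOp σ n (D * LinearMap.mulLeft ℝ f - LinearMap.mulLeft ℝ f * twist σ D))

variable {σ : A →ₐ[ℝ] A}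

@[simp]
theorem twist_apply (D : Module.End ℝ A) (f : A) : twist σ D f = σ (D (σ f)) := rfl

theorem IsSuperDiffOp.zero (n : ℕ) : IsSuperDiffOp σ n 0 := by
  have ht : twist σ (0 : Module.End ℝ A) = 0 := by ext; simp
  induction n with
  | zero => rfl
  | succ n ih => exact ⟨fun f _ => by simpa using ih, fun f _ => by simpa [ht] using ih⟩

theorem IsSuperDiffOp.add {n : ℕ} {D E : Module.End ℝ A} (hD : IsSuperDiffOp σ n D)
    (hE : IsSuperDiffOp σ n E) : IsSuperDiffOp σ n (D + E) := by
  induction n generalizing D E with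
  | zero =>
    rw [IsSuperDiffOp] at *
    simp [hD, hE]
  | succ n ih =>
    refine ⟨fun f hf => ?_, fun f hf => ?_⟩
    · convert ih (hD.1 f hf) (hE.1 f hf) using 1
      noncomm_ring
    · convert ih (hD.2 f hf) (hE.2 f hf) using 1
      have : twist σ (D + E) = twist σ D + twist σ E := by ext; simp
      rw [this]
      noncomm_ring

theorem IsSuperDiffOp.neg {n : ℕ} {D : Module.End ℝ A} (hD : IsSuperDiffOp σ n D) :
    IsSuperDiffOp σ n (-D) := by
  induction n generalizing D with
  | zero =>
    rw [IsSuperDiffOp] at *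
    simp [hD]
  | succ n ih =>
    refine ⟨fun f hf => ?_, fun f hf => ?_⟩
    · convert ih (hD.1 f hf) using 1
      ext g; simp; abel
    · convert ih (hD.2 f hf) using 1
      ext g; simp; abel

theorem IsSuperDiffOp.succ {n : ℕ} {D : Module.End ℝ A} (hD : IsSuperDiffOp σ n D) :
    IsSuperDiffOp σ (n + 1) D := by
  induction n generalizing D with
  | zero =>
    rw [IsSuperDiffOp] at hD
    rw [hD]
    exact IsSuperDiffOp.zero _
  | succ n ih => exact ⟨fun f hf => ih (hD.1 f hf), fun f hf => ih (hD.2 f hf)⟩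

theorem IsSuperDiffOp.mono {m n : ℕ} (h : m ≤ n) {D : Module.End ℝ A}
    (hD : IsSuperDiffOp σ m D) : IsSuperDiffOp σ n D := by
  induction n, h using Nat.le_induction with
  | base => exact hD
  | succ n _ ih => exact ih.succ

theorem twist_mul (hσ : IsSuperInvolution σ) (D E : Module.End ℝ A) :
    twist σ (D * E) = twist σ D * twist σ E := by
  ext g; simp [hσ.invol]

theorem IsSuperDiffOp.twist {n : ℕ} {D : Module.End ℝ A}
    (hD : IsSuperDiffOp σ n D) : IsSuperDiffOp σ n (twist σ D) := by
  induction n generalizing D with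
  | zero =>
    rw [IsSuperDiffOp] at *
    ext g; simp [hD]
  | succ n ih =>
    refine ⟨fun f hf => ?_, fun f hf => ?_⟩
    · convert ih (hD.1 f hf) using 1
      ext g; simp [hf]
    · convert (ih (hD.2 f hf)).neg using 1
      ext g; simp [hf]; abel

theorem IsSuperDiffOp.mulLeft (hσ : IsSuperInvolution σ) (h : A) :
    IsSuperDiffOp σ 1 (LinearMap.mulLeft ℝ h) := by
  refine ⟨fun f hf => ?_, fun f hf => ?_⟩
  · ext g
    simp [← mul_assoc, hσ.even_comm f h hf]
  · ext g
    simp [← mul_assoc, hσ.odd_comm f (σ h) hf, hσ.invol]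

/-- Operators of orders `< m` and `< n` compose to an operator of order `< m + n - 1`. -/
theorem IsSuperDiffOp.comp (hσ : IsSuperInvolution σ) {m n : ℕ} {D E : Module.End ℝ A}
    (hD : IsSuperDiffOp σ m D) (hE : IsSuperDiffOp σ n E) :
    IsSuperDiffOp σ (m + n - 1) (D * E) := by
  induction h : m + n generalizing m n D E with
  | zero =>
    obtain rfl : m = 0 := by omega
    rw [IsSuperDiffOp] at hD
    rw [hD, zero_mul]
    exact IsSuperDiffOp.zero _
  | succ l ih =>
    rcases m with _ | m
    · rw [IsSuperDiffOp] at hD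
      rw [hD, zero_mul]
      exact IsSuperDiffOp.zero _
    rcases n with _ | n
    · rw [IsSuperDiffOp] at hE
      rw [hE, mul_zero]
      exact IsSuperDiffOp.zero _
    obtain rfl : l = m + n + 1 := by omega
    rw [show m + n + 1 + 1 - 1 = m + n + 1 from rfl]
    refine ⟨fun f hf => ?_, fun f hf => ?_⟩
    · have h1 := ih hD (hE.1 f hf) (by omega)
      have h2 := ih (hD.1 f hf) hE (by omega)
      rw [show m + n = m + n + 1 - 1 from rfl]
      convert h1.add h2 using 1
      simp only [mul_sub, sub_mul, mul_assoc]
      abel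
    · have h1 := ih hD (hE.2 f hf) (by omega)
      have h2 := ih (hD.2 f hf) (hE.twist) (by omega)
      rw [show m + n = m + n + 1 - 1 from rfl]
      convert h1.add h2 using 1
      rw [twist_mul hσ]
      simp only [mul_sub, sub_mul, mul_assoc]
      abel

theorem IsSuperDiffOp.pow (hσ : IsSuperInvolution σ) {D : Module.End ℝ A}
    (hD : IsSuperDiffOp σ 2 D) (n : ℕ) : IsSuperDiffOp σ (n + 1) (D ^ n) := by
  induction n with
  | zero =>
    rw [pow_zero, zero_add, Module.End.one_eq_id, ← LinearMap.mulLeft_one]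
    exact IsSuperDiffOp.mulLeft hσ 1
  | succ n ih =>
    rw [pow_succ]
    exact ih.comp hσ hD

theorem IsSuperDiffOp.listProd (hσ : IsSuperInvolution σ) {ι : Type*} (D : ι → Module.End ℝ A)
    (n : ι → ℕ) (hD : ∀ i, IsSuperDiffOp σ (n i + 1) (D i)) (l : List ι) :
    IsSuperDiffOp σ ((l.map n).sum + 1) (l.map D).prod := by
  induction l with
  | nil =>
    rw [List.map_nil, List.map_nil, List.prod_nil, List.sum_nil, zero_add, Module.End.one_eq_id,
      ← LinearMap.mulLeft_one]
    exact IsSuperDiffOp.mulLeft hσ 1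
  | cons i l ih =>
    simp only [List.map_cons, List.prod_cons, List.sum_cons]
    exact ((hD i).comp hσ ih).mono (by omega)

/-- Even derivations are operators of order `≤ 1`. -/
theorem IsSuperDiffOp.of_even_derivation (hσ : IsSuperInvolution σ) {D : Module.End ℝ A}
    (ht : ∀ f, D (σ f) = σ (D f)) (hD : ∀ f g, D (f * g) = D f * g + f * D g) :
    IsSuperDiffOp σ 2 D := by
  refine ⟨fun f _ => ?_, fun f _ => ?_⟩ <;>
  · convert IsSuperDiffOp.mulLeft hσ (D f) using 1
    ext g
    simp [hD, ht, hσ.invol]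

/-- Odd derivations are operators of order `≤ 1`. -/
theorem IsSuperDiffOp.of_odd_derivation (hσ : IsSuperInvolution σ) {D : Module.End ℝ A}
    (ht : ∀ f, D (σ f) = -σ (D f)) (hD : ∀ f g, D (f * g) = D f * g + σ f * D g) :
    IsSuperDiffOp σ 2 D := by
  refine ⟨fun f hf => ?_, fun f hf => ?_⟩ <;>
  · convert IsSuperDiffOp.mulLeft hσ (D f) using 1
    ext g
    simp [hD, ht, hσ.invol, hf]

/-! ### Filtrations by powers of an ideal, and vanishing on products -/

/-- The span of the products `s₁ ⋯ sₙ a` with `sᵢ ∈ S`: the `n`-th power of the right ideal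
generated by `S` when `S` consists of homogeneous elements. -/
def powFiltration (S : Set A) : ℕ → Submodule ℝ A
  | 0 => ⊤
  | n + 1 => Submodule.span ℝ (Set.image2 (· * ·) S (powFiltration S n))

theorem mul_mem_powFiltration_succ {S : Set A} {n : ℕ} {s m : A} (hs : s ∈ S)
    (hm : m ∈ powFiltration S n) : s * m ∈ powFiltration S (n + 1) :=
  Submodule.subset_span ⟨s, hs, m, hm, rfl⟩

theorem powFiltration_succ_le {S : Set A} {n : ℕ} {T : Submodule ℝ A} :
    powFiltration S (n + 1) ≤ T ↔ ∀ s ∈ S, ∀ m ∈ powFiltration S n, s * m ∈ T := by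
  rw [powFiltration, Submodule.span_le, Set.image2_subset_iff]
  rfl

theorem powFiltration_mul_mem {S : Set A} {n : ℕ} {m : A} (hm : m ∈ powFiltration S n) (a : A) :
    m * a ∈ powFiltration S n := by
  induction n generalizing m with
  | zero => trivial
  | succ n ih =>
    have : powFiltration S (n + 1) ≤
        (powFiltration S (n + 1)).comap (LinearMap.mulRight ℝ a) := by
      rw [powFiltration_succ_le]
      intro s hs m hm
      simp only [Submodule.mem_comap, LinearMap.mulRight_apply, mul_assoc]
      exact mul_mem_powFiltration_succ hs (ih hm)
    exact this hm

/-- An operator of order `< k` lowers the filtration degree by at most `k - 1`. -/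
theorem IsSuperDiffOp.map_powFiltration {S : Set A}
    (hS : ∀ s ∈ S, σ s = s ∨ σ s = -s) {k : ℕ} {D : Module.End ℝ A}
    (hD : IsSuperDiffOp σ k D) (n : ℕ) {x : A} (hx : x ∈ powFiltration S (n + k)) :
    D x ∈ powFiltration S (n + 1) := by
  induction k generalizing D n x with
  | zero =>
    rw [IsSuperDiffOp] at hD
    simp [hD]
  | succ k ihk =>
    induction n generalizing D x with
    | zero =>
      have : powFiltration S (0 + k + 1) ≤ (powFiltration S 1).comap D := by
        rw [powFiltration_succ_le]
        intro s hs m hm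
        have key : ∀ E : Module.End ℝ A,
            IsSuperDiffOp σ k (D * LinearMap.mulLeft ℝ s - LinearMap.mulLeft ℝ s * E) →
            D (s * m) ∈ powFiltration S 1 := by
          intro E hE
          have h1 := ihk hE 0 hm
          have h2 : s * E m ∈ powFiltration S 1 := mul_mem_powFiltration_succ hs trivial
          simpa using add_mem h1 h2
        rcases hS s hs with h | h
        · exact key _ (hD.1 s h)
        · exact key _ (hD.2 s h)
      exact this hx
    | succ n ihn =>
      have : powFiltration S (n + 1 + k + 1) ≤ (powFiltration S (n + 1 + 1)).comap D := by
        rw [powFiltration_succ_le]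
        intro s hs m hm
        have key : ∀ E : Module.End ℝ A, IsSuperDiffOp σ (k + 1) E →
            IsSuperDiffOp σ k (D * LinearMap.mulLeft ℝ s - LinearMap.mulLeft ℝ s * E) →
            D (s * m) ∈ powFiltration S (n + 1 + 1) := by
          intro E hE' hE
          have h1 := ihk hE (n + 1) hm
          have h2 : s * E m ∈ powFiltration S (n + 1 + 1) :=
            mul_mem_powFiltration_succ hs (ihn hE' (by convert hm using 2; omega))
          simpa using add_mem h1 h2
        rcases hS s hs with h | h
        · exact key _ hD (hD.1 s h)
        · exact key _ (hD.twist) (hD.2 s h)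
      exact this hx

/-- An operator of order `< k` that kills all products of fewer than `k` elements of a set `S` of
homogeneous elements kills all products of elements of `S`. -/
theorem IsSuperDiffOp.listProd_eq_zero {S : Set A}
    (hS : ∀ s ∈ S, σ s = s ∨ σ s = -s) {k : ℕ} {D : Module.End ℝ A}
    (hD : IsSuperDiffOp σ k D)
    (h0 : ∀ l : List A, (∀ s ∈ l, s ∈ S) → l.length < k → D l.prod = 0)
    (l : List A) (hl : ∀ s ∈ l, s ∈ S) : D l.prod = 0 := by
  have hprod : ∀ l : List A, (∀ s ∈ l, s ∈ S) → σ l.prod = l.prod ∨ σ l.prod = -l.prod := by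
    intro l hl
    induction l with
    | nil => simp
    | cons s t ih =>
      have h1 := hS s (hl s (by simp))
      have h2 := ih fun s hs => hl s (by simp [hs])
      rw [List.prod_cons, map_mul]
      rcases h1 with h1 | h1 <;> rcases h2 with h2 | h2 <;> simp [h1, h2]
  have htw : ∀ (D : Module.End ℝ A) (l : List A), (∀ s ∈ l, s ∈ S) → D l.prod = 0 →
      Supergeometry.twist σ D l.prod = 0 := by
    intro D l hl h
    rcases hprod l hl with h1 | h1 <;> simp [h1, h]
  induction k generalizing D l with
  | zero =>
    rw [IsSuperDiffOp] at hD
    simp [hD]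
  | succ k ihk =>
    induction l with
    | nil => exact h0 [] (by simp) (by simp)
    | cons s t iht =>
      have hs := hl s (by simp)
      have ht : ∀ s ∈ t, s ∈ S := fun s hs => hl s (by simp [hs])
      have key : ∀ E : Module.End ℝ A,
          (∀ l : List A, (∀ s ∈ l, s ∈ S) → D l.prod = 0 → E l.prod = 0) →
          IsSuperDiffOp σ k (D * LinearMap.mulLeft ℝ s - LinearMap.mulLeft ℝ s * E) →
          D (s * t.prod) = 0 := by
        intro E hE hDE
        have hprod0 : ∀ l : List A, (∀ s ∈ l, s ∈ S) → l.length < k →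
            (D * LinearMap.mulLeft ℝ s - LinearMap.mulLeft ℝ s * E) l.prod = 0 := by
          intro l hl hlk
          have h1 := h0 (s :: l) (by simpa [hs] using hl) (by simpa using hlk)
          have h2 := hE l hl (h0 l hl (by omega))
          rw [List.prod_cons] at h1
          simp [h1, h2]
        have h1 := ihk hDE hprod0 t ht
        have h2 := hE t ht (iht ht)
        simpa [h2] using h1
      rw [List.prod_cons]
      rcases hS s hs with h | h
      · exact key D (fun _ _ h => h) (hD.1 s h)
      · exact key _ (htw D) (hD.2 s h)

end Involution

/-! ### Comparison with the supercommutator -/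

section Comparison

variable {A : Type*} [Ring A] [Algebra ℝ A]

/-- Transport of operators along an isomorphism of algebras that respects the involutions. -/
theorem IsSuperDiffOp.conj {B : Type*} [Ring B] [Algebra ℝ B] {σ : A →ₐ[ℝ] A} {τ : B →ₐ[ℝ] B}
    (e : A ≃ₐ[ℝ] B) (he : ∀ f, e (σ f) = τ (e f)) {n : ℕ} {D : Module.End ℝ A}
    {E : Module.End ℝ B} (hDE : ∀ f, e (D f) = E (e f)) (hD : IsSuperDiffOp σ n D) :
    IsSuperDiffOp τ n E := by
  induction n generalizing D E with
  | zero =>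
    rw [IsSuperDiffOp] at *
    ext g
    obtain ⟨f, rfl⟩ := e.surjective g
    simp [← hDE, hD]
  | succ n ih =>
    refine ⟨fun g hg => ?_, fun g hg => ?_⟩
    · obtain ⟨f, rfl⟩ := e.surjective g
      refine ih (fun f' => ?_) (hD.1 f (e.injective (by rw [he, hg])))
      simp [hDE]
    · obtain ⟨f, rfl⟩ := e.surjective g
      refine ih (fun f' => ?_) (hD.2 f (e.injective (by rw [he, hg, map_neg])))
      simp [hDE, he]

theorem IsSuperInvolution.conj {B : Type*} [Ring B] [Algebra ℝ B] {σ : A →ₐ[ℝ] A}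
    {τ : B →ₐ[ℝ] B} (e : A ≃ₐ[ℝ] B) (he : ∀ f, e (σ f) = τ (e f)) (hσ : IsSuperInvolution σ) :
    IsSuperInvolution τ where
  invol g := by
    obtain ⟨f, rfl⟩ := e.surjective g
    rw [← he, ← he, hσ.invol]
  even_comm g g' hg := by
    obtain ⟨f, rfl⟩ := e.surjective g
    obtain ⟨f', rfl⟩ := e.surjective g'
    rw [← map_mul, ← map_mul, hσ.even_comm f f' (e.injective (by rw [he, hg]))]
  odd_comm g g' hg := by
    obtain ⟨f, rfl⟩ := e.surjective g
    obtain ⟨f', rfl⟩ := e.surjective g'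
    rw [← he, ← map_mul, ← map_mul,
      hσ.odd_comm f f' (e.injective (by rw [he, hg, map_neg]))]

variable (P : ZMod 2 → Submodule ℝ A) [GradedAlgebra P]

theorem proj_zero_add_proj_one (f : A) :
    GradedAlgebra.proj P 0 f + GradedAlgebra.proj P 1 f = f := by
  have := sum_proj P f
  rwa [show (Finset.univ : Finset (ZMod 2)) = {0, 1} from rfl, Finset.sum_pair (by decide)] at this

theorem proj_of_mem {i : ZMod 2} {f : A} (hf : f ∈ P i) : GradedAlgebra.proj P i f = f := by
  rw [GradedAlgebra.proj_apply, DirectSum.decompose_of_mem_same P hf]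

theorem proj_of_mem_ne {i j : ZMod 2} {f : A} (hf : f ∈ P i) (h : i ≠ j) :
    GradedAlgebra.proj P j f = 0 := by
  rw [GradedAlgebra.proj_apply, DirectSum.decompose_of_mem_ne P hf h]

theorem proj_mem (i : ZMod 2) (f : A) : GradedAlgebra.proj P i f ∈ P i := by
  simp

/-- The parity involution of a `ℤ/2`-graded algebra, `f ↦ f₀ - f₁`. -/
def parityInvolution : A →ₐ[ℝ] A :=
  AlgHom.ofLinearMap (GradedAlgebra.proj P 0 - GradedAlgebra.proj P 1)
    (by
      have h1 : (1 : A) ∈ P 0 := SetLike.GradedOne.one_mem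
      simp only [LinearMap.sub_apply, proj_of_mem P h1, proj_of_mem_ne P h1 zero_ne_one, sub_zero])
    (by
      have hom : ∀ (i j : ZMod 2) (f g : A), f ∈ P i → g ∈ P j →
          (GradedAlgebra.proj P 0 - GradedAlgebra.proj P 1) (f * g) =
          (GradedAlgebra.proj P 0 - GradedAlgebra.proj P 1) f *
          (GradedAlgebra.proj P 0 - GradedAlgebra.proj P 1) g := by
        intro i j f g hf hg
        have hfg : f * g ∈ P (i + j) := SetLike.mul_mem_graded hf hg
        have hval : ∀ (i : ZMod 2) (f : A), f ∈ P i →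
            (GradedAlgebra.proj P 0 - GradedAlgebra.proj P 1) f = if i = 0 then f else -f := by
          intro i f hf
          rcases zmod_two_cases i with rfl | rfl
          · rw [LinearMap.sub_apply, proj_of_mem P hf, proj_of_mem_ne P hf zero_ne_one, if_pos rfl,
              sub_zero]
          · rw [LinearMap.sub_apply, proj_of_mem P hf, proj_of_mem_ne P hf one_ne_zero,
              if_neg one_ne_zero, zero_sub]
        rw [hval _ _ hf, hval _ _ hg, hval _ _ hfg]
        have h2 : (1 : ZMod 2) + 1 = 0 := rfl
        rcases zmod_two_cases i with rfl | rfl <;> rcases zmod_two_cases j with rfl | rfl <;>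
          simp [h2]
      intro f g
      conv_lhs => rw [← proj_zero_add_proj_one P f, ← proj_zero_add_proj_one P g]
      conv_rhs => rw [← proj_zero_add_proj_one P f, ← proj_zero_add_proj_one P g]
      simp only [add_mul, mul_add, map_add]
      rw [hom _ _ _ _ (proj_mem P 0 f) (proj_mem P 0 g),
        hom _ _ _ _ (proj_mem P 0 f) (proj_mem P 1 g),
        hom _ _ _ _ (proj_mem P 1 f) (proj_mem P 0 g),
        hom _ _ _ _ (proj_mem P 1 f) (proj_mem P 1 g)])

theorem parityInvolution_apply (f : A) :
    parityInvolution P f = GradedAlgebra.proj P 0 f - GradedAlgebra.proj P 1 f := rfl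

theorem parityInvolution_of_mem_zero {f : A} (hf : f ∈ P 0) : parityInvolution P f = f := by
  rw [parityInvolution_apply, proj_of_mem P hf, proj_of_mem_ne P hf zero_ne_one, sub_zero]

theorem parityInvolution_of_mem_one {f : A} (hf : f ∈ P 1) : parityInvolution P f = -f := by
  rw [parityInvolution_apply, proj_of_mem P hf, proj_of_mem_ne P hf one_ne_zero, zero_sub]

theorem mem_zero_iff {f : A} : f ∈ P 0 ↔ parityInvolution P f = f := by
  refine ⟨parityInvolution_of_mem_zero P, fun h => ?_⟩
  have h1 := proj_zero_add_proj_one P f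
  rw [parityInvolution_apply] at h
  have : f = GradedAlgebra.proj P 0 f := by
    have h2 : (2 : ℝ) • f = (2 : ℝ) • GradedAlgebra.proj P 0 f := by
      calc (2 : ℝ) • f = (GradedAlgebra.proj P 0 f + GradedAlgebra.proj P 1 f) +
            (GradedAlgebra.proj P 0 f - GradedAlgebra.proj P 1 f) := by rw [h1, h, two_smul]
        _ = _ := by rw [two_smul]; abel
    exact smul_right_injective A (two_ne_zero (α := ℝ)) h2
  rw [this]
  exact proj_mem P 0 f

theorem mem_one_iff {f : A} : f ∈ P 1 ↔ parityInvolution P f = -f := by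
  refine ⟨parityInvolution_of_mem_one P, fun h => ?_⟩
  have h1 := proj_zero_add_proj_one P f
  rw [parityInvolution_apply] at h
  have : f = GradedAlgebra.proj P 1 f := by
    have h2 : (2 : ℝ) • f = (2 : ℝ) • GradedAlgebra.proj P 1 f := by
      calc (2 : ℝ) • f = (GradedAlgebra.proj P 0 f + GradedAlgebra.proj P 1 f) -
            (GradedAlgebra.proj P 0 f - GradedAlgebra.proj P 1 f) := by
              rw [h1, h, two_smul, sub_neg_eq_add]
        _ = _ := by rw [two_smul]; abel
    exact smul_right_injective A (two_ne_zero (α := ℝ)) h2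
  rw [this]
  exact proj_mem P 1 f

theorem isSuperInvolution_parityInvolution
    (hP : ∀ (i j : ZMod 2) (f g : A), f ∈ P i → g ∈ P j →
      f * g = (-1 : ℝ) ^ (i.val * j.val) • (g * f)) :
    IsSuperInvolution (parityInvolution P) where
  invol f := by
    nth_rw 2 [parityInvolution_apply]
    rw [map_sub, parityInvolution_of_mem_zero P (proj_mem P 0 f),
      parityInvolution_of_mem_one P (proj_mem P 1 f), sub_neg_eq_add, proj_zero_add_proj_one]
  even_comm f g hf := by
    rw [← mem_zero_iff] at hf
    rw [← proj_zero_add_proj_one P g, mul_add, add_mul, hP 0 0 f _ hf (proj_mem P 0 g),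
      hP 0 1 f _ hf (proj_mem P 1 g)]
    simp
  odd_comm f g hf := by
    rw [← mem_one_iff] at hf
    rw [parityInvolution_apply]
    nth_rw 1 [← proj_zero_add_proj_one P g]
    have h1 : (1 : ZMod 2).val = 1 := rfl
    rw [mul_add, sub_mul, hP 1 0 f _ hf (proj_mem P 0 g),
      hP 1 1 f _ hf (proj_mem P 1 g)]
    simp [h1, sub_eq_add_neg]

theorem supercommutator_of_even (D : Module.End ℝ A) {f : A} (hf : f ∈ P 0) :
    supercommutator P D (LinearMap.mulLeft ℝ f) =
      D * LinearMap.mulLeft ℝ f - LinearMap.mulLeft ℝ f * D := by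
  rw [supercommutator_mulLeft_of_mem P 0 f hf]
  congr 1
  ext g
  have h2 : (1 : ZMod 2) + 1 = 0 := rfl
  rw [show (Finset.univ : Finset (ZMod 2)) = {0, 1} from rfl, Finset.sum_pair (by decide)]
  simp only [endComponent, show (Finset.univ : Finset (ZMod 2)) = {0, 1} from rfl,
    Finset.sum_pair (show (0 : ZMod 2) ≠ 1 by decide), h2, zero_add, add_zero, ZMod.val_zero,
    mul_zero, pow_zero, one_smul, LinearMap.add_apply, LinearMap.smul_apply,
    Module.End.mul_apply, LinearMap.mulLeft_apply, smul_eq_mul, ← mul_add]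
  congr 1
  nth_rw 5 [← proj_zero_add_proj_one P g]
  rw [map_add, ← proj_zero_add_proj_one P (D (GradedAlgebra.proj P 0 g)),
    ← proj_zero_add_proj_one P (D (GradedAlgebra.proj P 1 g))]
  simp only [map_add, proj_of_mem P (proj_mem P _ _),
    proj_of_mem_ne P (proj_mem P 0 _) zero_ne_one, proj_of_mem_ne P (proj_mem P 1 _) one_ne_zero]
  abel

theorem supercommutator_of_odd (D : Module.End ℝ A) {f : A} (hf : f ∈ P 1) :
    supercommutator P D (LinearMap.mulLeft ℝ f) =
      D * LinearMap.mulLeft ℝ f - LinearMap.mulLeft ℝ f * twist (parityInvolution P) D := by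
  rw [supercommutator_mulLeft_of_mem P 1 f hf]
  congr 1
  ext g
  have h2 : (1 : ZMod 2) + 1 = 0 := rfl
  have h1 : (1 : ZMod 2).val = 1 := rfl
  rw [show (Finset.univ : Finset (ZMod 2)) = {0, 1} from rfl, Finset.sum_pair (by decide)]
  simp only [endComponent, show (Finset.univ : Finset (ZMod 2)) = {0, 1} from rfl,
    Finset.sum_pair (show (0 : ZMod 2) ≠ 1 by decide), h2, zero_add, add_zero, ZMod.val_zero,
    h1, mul_one, pow_zero, pow_one, one_smul, neg_smul, LinearMap.add_apply,
    LinearMap.smul_apply, Module.End.mul_apply, LinearMap.mulLeft_apply, smul_eq_mul, twist_apply,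
    parityInvolution_apply, map_sub]
  simp only [mul_add]
  abel

/-- By additivity in `f` it suffices to take supercommutators with homogeneous `f`, so that the
`k`-th order superdifferential operators are those of order `< k + 1` in the sense of
`IsSuperDiffOp`. -/
theorem mem_diffOps_iff (hP : ∀ (i j : ZMod 2) (f g : A), f ∈ P i → g ∈ P j →
      f * g = (-1 : ℝ) ^ (i.val * j.val) • (g * f)) (k : ℕ) (D : Module.End ℝ A) :
    D ∈ diffOps P hP k ↔ IsSuperDiffOp (parityInvolution P) (k + 1) D := by
  have main : ∀ (n : ℕ) (N : Submodule A (Module.End ℝ A))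
      (_ : ∀ D, D ∈ N ↔ IsSuperDiffOp (parityInvolution P) n D) (D : Module.End ℝ A),
      D ∈ commutatorInto P hP N ↔ IsSuperDiffOp (parityInvolution P) (n + 1) D := by
    intro n N hN D
    change (∀ f : A, supercommutator P D (LinearMap.mulLeft ℝ f) ∈ N) ↔ _
    constructor
    · intro h
      refine ⟨fun f hf => ?_, fun f hf => ?_⟩
      · rw [← supercommutator_of_even P D ((mem_zero_iff P).2 hf), ← hN]
        exact h f
      · rw [← supercommutator_of_odd P D ((mem_one_iff P).2 hf), ← hN]
        exact h f
    · intro h f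
      have e : LinearMap.mulLeft ℝ f = LinearMap.mulLeft ℝ (GradedAlgebra.proj P 0 f) +
          LinearMap.mulLeft ℝ (GradedAlgebra.proj P 1 f) := by
        ext y
        simp only [LinearMap.add_apply, LinearMap.mulLeft_apply, ← add_mul,
          proj_zero_add_proj_one]
      rw [e, supercommutator_add_right]
      refine N.add_mem ?_ ?_
      · rw [hN, supercommutator_of_even P D (proj_mem P 0 f)]
        exact h.1 _ ((mem_zero_iff P).1 (proj_mem P 0 f))
      · rw [hN, supercommutator_of_odd P D (proj_mem P 1 f)]
        exact h.2 _ ((mem_one_iff P).1 (proj_mem P 1 f))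
  induction k generalizing D with
  | zero => exact main 0 ⊥ (fun D => Iff.rfl) D
  | succ k ih => exact main (k + 1) _ ih D

/-! ### Bases from triangular evaluations -/

/-- Operators `δ i` form a basis of a module `N` of operators if they are triangular with respect
to elements `z i`, graded by `d`, and an operator of `N` is determined by its values on the
`z i`. -/
theorem exists_basis_of_triangular {I : Type*} [Finite I] (N : Submodule A (Module.End ℝ A))
    (δ : I → N) (z : I → A) (d : I → ℕ)
    (hunit : ∀ i, IsUnit ((δ i : Module.End ℝ A) (z i)))
    (htri : ∀ i j, d j ≤ d i → i ≠ j → (δ i : Module.End ℝ A) (z j) = 0)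
    (hker : ∀ D ∈ N, (∀ i, D (z i) = 0) → D = 0) :
    ∃ b : Module.Basis I A N, ∀ i, b i = δ i := by
  classical
  have := Fintype.ofFinite I
  have happ : ∀ (s : Finset I) (g : I → A) (j : I),
      ((∑ i ∈ s, g i • δ i : N) : Module.End ℝ A) (z j) =
        ∑ i ∈ s, g i * (δ i : Module.End ℝ A) (z j) := by
    intro s g j
    simp [LinearMap.sum_apply]
  have hli : LinearIndependent A δ := by
    rw [Fintype.linearIndependent_iff (R := A) (M := N)]
    intro g hg i
    induction h : d i using Nat.strong_induction_on generalizing i with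
    | _ n ih =>
      have h1 := happ Finset.univ g i
      rw [hg, Finset.sum_eq_single i] at h1
      · simpa [(hunit i).mul_left_eq_zero] using h1.symm
      · intro j _ hj
        rcases lt_or_ge (d j) (d i) with hlt | hge
        · rw [ih (d j) (h ▸ hlt) j rfl, zero_mul]
        · rw [htri j i hge hj, mul_zero]
      · simp
  have hstep : ∀ (n : ℕ) (D : N), ∃ E ∈ Submodule.span A (Set.range δ),
      ∀ i, d i < n → (D : Module.End ℝ A) (z i) - (E : Module.End ℝ A) (z i) = 0 := by
    intro n D
    induction n with
    | zero => exact ⟨0, zero_mem _, by simp⟩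
    | succ n ih =>
      obtain ⟨E, hE, h⟩ := ih
      choose c hc using hunit
      -- the degree `n` part of the error is corrected by inverting the diagonal entries
      set g : I → A := fun i =>
        ((D : Module.End ℝ A) (z i) - (E : Module.End ℝ A) (z i)) * ↑(c i)⁻¹ with hg
      refine ⟨E + ∑ i with d i = n, g i • δ i, add_mem hE (Submodule.sum_mem _ fun i _ =>
        Submodule.smul_mem _ _ (Submodule.subset_span ⟨i, rfl⟩)), fun j hj => ?_⟩
      rw [Submodule.coe_add, LinearMap.add_apply, happ, ← sub_sub]
      rcases Nat.lt_succ_iff_lt_or_eq.1 hj with hlt | heq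
      · rw [h j hlt, Finset.sum_eq_zero, sub_zero]
        intro i hi
        have hi : d i = n := by simpa using hi
        rw [htri i j (by omega) (by rintro rfl; omega), mul_zero]
      · rw [Finset.sum_eq_single j]
        · simp only [hg]
          rw [← hc j, mul_assoc, Units.inv_mul, mul_one, sub_self]
        · intro i hi hij
          have hi : d i = n := by simpa using hi
          rw [htri i j (by omega) hij, mul_zero]
        · intro hj'
          simp [heq] at hj'
  refine ⟨Module.Basis.mk hli fun D _ => ?_, fun i => Module.Basis.mk_apply _ _ _⟩
  obtain ⟨E, hE, h⟩ := hstep (Finset.univ.sup d + 1) D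
  have h0 := hker ((D : Module.End ℝ A) - E) (N.sub_mem D.2 E.2) fun i =>
    h i (Nat.lt_succ_of_le (Finset.le_sup (Finset.mem_univ i)))
  rwa [show D = E from Subtype.ext (sub_eq_zero.1 h0)]

end Comparison

end Supergeometry

end

noncomputable section

namespace Supergeometry

/-! ### The exterior algebra and its contractions -/

section Grassmann

variable {q : ℕ}

/-- The generator `ξ^a` of the Grassmann algebra. -/
def gen (a : Fin q) : Grassmann q := ExteriorAlgebra.ι ℝ (Pi.single a 1)

/-- The odd derivative `∂/∂ξ^a` of the Grassmann algebra. -/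
def genDeriv (a : Fin q) : Module.End ℝ (Grassmann q) :=
  CliffordAlgebra.contractLeft (Q := (0 : QuadraticForm ℝ (Fin q → ℝ))) (LinearMap.proj a)

/-- The product of the powers `(ξ^a)^{β^a}` in the order of the list `l`. -/
def genMonomial (l : List (Fin q)) (β : Fin q → Fin 2) : Grassmann q :=
  (l.map fun a => gen a ^ (β a : ℕ)).prod

/-- The product of the operators `∂_{ξ^a}^{β^a}` in the order opposite to that of the list `l`. -/
def genDerivMulti (l : List (Fin q)) (β : Fin q → Fin 2) : Module.End ℝ (Grassmann q) :=
  (l.map fun a => genDeriv a ^ (β a : ℕ)).reverse.prod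

theorem fin_two_cases (b : Fin 2) : b = 0 ∨ b = 1 := by
  revert b
  decide

theorem gen_mul_self (a : Fin q) : gen a * gen a = 0 := ExteriorAlgebra.ι_sq_zero _

theorem gen_mul_swap (a b : Fin q) : gen a * gen b = -(gen b * gen a) :=
  eq_neg_of_add_eq_zero_left (ExteriorAlgebra.ι_add_mul_swap _ _)

theorem genDeriv_gen_mul (a b : Fin q) (w : Grassmann q) :
    genDeriv a (gen b * w) = (if a = b then w else 0) - gen b * genDeriv a w := by
  refine (CliffordAlgebra.contractLeft_ι_mul (Q := (0 : QuadraticForm ℝ (Fin q → ℝ)))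
    (LinearMap.proj a) (Pi.single b 1) w).trans ?_
  rw [LinearMap.proj_apply, Pi.single_apply, ite_smul, one_smul, zero_smul]
  rfl

theorem genDeriv_one (a : Fin q) : genDeriv a 1 = 0 :=
  CliffordAlgebra.contractLeft_one _ _

@[simp]
theorem genMonomial_nil (β : Fin q → Fin 2) : genMonomial [] β = 1 := rfl

theorem genMonomial_cons (b : Fin q) (l : List (Fin q)) (β : Fin q → Fin 2) :
    genMonomial (b :: l) β = gen b ^ (β b : ℕ) * genMonomial l β := by
  simp [genMonomial]

@[simp]
theorem genDerivMulti_nil (β : Fin q → Fin 2) : genDerivMulti [] β = 1 := rfl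

theorem genDerivMulti_cons (b : Fin q) (l : List (Fin q)) (β : Fin q → Fin 2) :
    genDerivMulti (b :: l) β = genDerivMulti l β * genDeriv b ^ (β b : ℕ) := by
  simp [genDerivMulti]

theorem genMonomial_congr {l : List (Fin q)} {β β' : Fin q → Fin 2}
    (h : ∀ a ∈ l, β a = β' a) : genMonomial l β = genMonomial l β' := by
  unfold genMonomial
  congr 1
  exact List.map_congr_left fun a ha => by rw [h a ha]

theorem gen_mul_genMonomial_of_one {l : List (Fin q)} {a : Fin q} (ha : a ∈ l)
    {β : Fin q → Fin 2} (hβ : β a = 1) : gen a * genMonomial l β = 0 := by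
  induction l with
  | nil => simp at ha
  | cons b l ih =>
    rw [genMonomial_cons, ← mul_assoc]
    rcases List.mem_cons.1 ha with rfl | ha
    · simp [hβ, gen_mul_self]
    · rcases fin_two_cases (β b) with h | h
      · simp [h, ih ha]
      · simp [h, gen_mul_swap a b, mul_assoc, ih ha]

theorem gen_mul_genMonomial_of_zero {l : List (Fin q)} (hl : l.Nodup) {a : Fin q} (ha : a ∈ l)
    {β : Fin q → Fin 2} (hβ : β a = 0) :
    ∃ s : ℝ, gen a * genMonomial l β = s • genMonomial l (Function.update β a 1) := by
  induction l with
  | nil => simp at ha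
  | cons b l ih =>
    rw [List.nodup_cons] at hl
    rw [genMonomial_cons, genMonomial_cons, ← mul_assoc]
    by_cases hab : a = b
    · subst hab
      refine ⟨1, ?_⟩
      rw [genMonomial_congr (l := l) (β := Function.update β a 1) (β' := β) fun c hc => by
        rw [Function.update_of_ne]; rintro rfl; exact hl.1 hc]
      simp [hβ]
    · obtain ⟨s, hs⟩ := ih hl.2 ((List.mem_cons.1 ha).resolve_left hab)
      rw [Function.update_of_ne (Ne.symm hab)]
      rcases fin_two_cases (β b) with h | h
      · exact ⟨s, by simp [h, hs]⟩
      · exact ⟨-s, by simp [h, gen_mul_swap a b, mul_assoc, hs]⟩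

theorem genDeriv_genMonomial_of_notMem {l : List (Fin q)} {a : Fin q} (ha : a ∉ l)
    (β : Fin q → Fin 2) : genDeriv a (genMonomial l β) = 0 := by
  induction l with
  | nil => exact genDeriv_one a
  | cons b l ih =>
    rw [List.mem_cons, not_or] at ha
    rw [genMonomial_cons]
    rcases fin_two_cases (β b) with h | h
    · simp [h, ih ha.2]
    · simp [h, genDeriv_gen_mul, ha.1, ih ha.2]

theorem genDerivMulti_gen_mul_of_notMem {l : List (Fin q)} {b : Fin q} (hb : b ∉ l)
    (β : Fin q → Fin 2) (w : Grassmann q) :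
    ∃ s : ℝ, genDerivMulti l β (gen b * w) = s • (gen b * genDerivMulti l β w) := by
  induction l generalizing w with
  | nil => exact ⟨1, by simp⟩
  | cons c l ih =>
    rw [List.mem_cons, not_or] at hb
    rw [genDerivMulti_cons]
    rcases fin_two_cases (β c) with h | h
    · obtain ⟨s, hs⟩ := ih hb.2 w
      exact ⟨s, by simp [h, hs]⟩
    · obtain ⟨s, hs⟩ := ih hb.2 (genDeriv c w)
      exact ⟨-s, by simp [h, genDeriv_gen_mul, Ne.symm hb.1, hs]⟩

theorem genDerivMulti_genMonomial_self {l : List (Fin q)} (hl : l.Nodup) (β : Fin q → Fin 2) :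
    genDerivMulti l β (genMonomial l β) = 1 := by
  induction l with
  | nil => simp
  | cons b l ih =>
    rw [List.nodup_cons] at hl
    rw [genDerivMulti_cons, genMonomial_cons]
    rcases fin_two_cases (β b) with h | h
    · simp [h, ih hl.2]
    · simp [h, genDeriv_gen_mul, genDeriv_genMonomial_of_notMem hl.1, ih hl.2]

theorem genDerivMulti_genMonomial_eq_zero {l : List (Fin q)} (hl : l.Nodup) {a : Fin q}
    (ha : a ∈ l) {β β' : Fin q → Fin 2} (hβ : β a = 1) (hβ' : β' a = 0) :
    genDerivMulti l β (genMonomial l β') = 0 := by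
  induction l with
  | nil => simp at ha
  | cons b l ih =>
    rw [List.nodup_cons] at hl
    rw [genDerivMulti_cons, genMonomial_cons]
    by_cases hab : a = b
    · subst hab
      simp [hβ, hβ', genDeriv_genMonomial_of_notMem hl.1]
    · have ih := ih hl.2 ((List.mem_cons.1 ha).resolve_left hab)
      rcases fin_two_cases (β b) with h | h <;> rcases fin_two_cases (β' b) with h' | h'
      · simp [h, h', ih]
      · obtain ⟨s, hs⟩ := genDerivMulti_gen_mul_of_notMem hl.1 β (genMonomial l β')
        simp [h, h', hs, ih]
      · simp [h, h', genDeriv_genMonomial_of_notMem hl.1]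
      · simp [h, h', genDeriv_gen_mul, genDeriv_genMonomial_of_notMem hl.1, ih]

/-- The Grassmann algebra is generated by the `ξ^a`. -/
theorem adjoin_range_gen : Algebra.adjoin ℝ (Set.range (gen (q := q))) = ⊤ := by
  rw [eq_top_iff]
  intro w _
  induction w using ExteriorAlgebra.induction with
  | algebraMap r => exact Subalgebra.algebraMap_mem _ r
  | ι v =>
    have : v = ∑ a, v a • (Pi.single a 1 : Fin q → ℝ) := by
      ext b
      simp [Finset.sum_apply, Pi.single_apply]
    rw [this, map_sum]
    refine Subalgebra.sum_mem _ fun a _ => ?_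
    rw [map_smul]
    exact Subalgebra.smul_mem _ (Algebra.subset_adjoin (Set.mem_range_self a)) _
  | mul a b ha hb => exact Subalgebra.mul_mem _ (ha trivial) (hb trivial)
  | add a b ha hb => exact Subalgebra.add_mem _ (ha trivial) (hb trivial)

end Grassmann

/-! ### Smooth functions and their derivatives -/

section Smooth

variable {p : ℕ} {W : Opens (EuclideanSpace ℝ (Fin p))}

theorem SmoothFn.ext0_apply (f : SmoothFn W) (x : W) : f.ext0 x = f x :=
  Subtype.val_injective.extend_apply _ _ _

theorem SmoothFn.ext0_mul (f g : SmoothFn W) : (f * g).ext0 = f.ext0 * g.ext0 := by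
  unfold SmoothFn.ext0
  rw [← Function.extend_mul]
  simp

/-- A function smooth at the points of `W` restricts to a smooth function on `W`. -/
def SmoothFn.ofContDiffAt (F : EuclideanSpace ℝ (Fin p) → ℝ) (hF : ∀ x ∈ W, ContDiffAt ℝ ∞ F x) :
    SmoothFn W :=
  ⟨fun x => F x, fun x =>
    (contMDiffAt_subtype_iff (f := F)).2 (contMDiffAt_iff_contDiffAt.2 (hF x x.2))⟩

@[simp]
theorem SmoothFn.ofContDiffAt_apply (F : EuclideanSpace ℝ (Fin p) → ℝ)
    (hF : ∀ x ∈ W, ContDiffAt ℝ ∞ F x) (x : W) : SmoothFn.ofContDiffAt F hF x = F x := rfl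

theorem SmoothFn.ext0_eventuallyEq {f : SmoothFn W} {F : EuclideanSpace ℝ (Fin p) → ℝ}
    (h : ∀ x : W, f x = F x) (x : W) : f.ext0 =ᶠ[nhds (x : EuclideanSpace ℝ (Fin p))] F := by
  filter_upwards [W.isOpen.mem_nhds x.2] with y hy
  exact (f.ext0_apply ⟨y, hy⟩).trans (h _)

theorem SmoothFn.partialX_apply (i : Fin p) (f : SmoothFn W) (x : W) :
    SmoothFn.partialX W i f x = fderiv ℝ f.ext0 x (EuclideanSpace.single i 1) := rfl

theorem SmoothFn.partialX_mul (i : Fin p) (f g : SmoothFn W) :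
    SmoothFn.partialX W i (f * g) = SmoothFn.partialX W i f * g + f * SmoothFn.partialX W i g := by
  ext x
  rw [SmoothFn.partialX_apply, SmoothFn.ext0_mul,
    fderiv_mul ((f.contDiffAt_ext0 x).differentiableAt (by simp))
      ((g.contDiffAt_ext0 x).differentiableAt (by simp))]
  change f.ext0 x * SmoothFn.partialX W i g x + g.ext0 x * SmoothFn.partialX W i f x =
    SmoothFn.partialX W i f x * g x + f x * SmoothFn.partialX W i g x
  rw [SmoothFn.ext0_apply, SmoothFn.ext0_apply]
  ring

theorem SmoothFn.partialX_one (i : Fin p) : SmoothFn.partialX W i 1 = 0 := by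
  have := SmoothFn.partialX_mul (W := W) i 1 1
  simpa using this

theorem SmoothFn.res_apply {W' : Opens (EuclideanSpace ℝ (Fin p))} (h : W' ≤ W) (f : SmoothFn W)
    (x : W') : SmoothFn.res h f x = f ⟨x, h x.2⟩ := rfl

theorem SmoothFn.partialX_res {W' : Opens (EuclideanSpace ℝ (Fin p))} (h : W' ≤ W) (i : Fin p)
    (f : SmoothFn W) :
    SmoothFn.partialX W' i (SmoothFn.res h f) = SmoothFn.res h (SmoothFn.partialX W i f) := by
  ext x
  rw [SmoothFn.partialX_apply, SmoothFn.res_apply, SmoothFn.partialX_apply,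
    (SmoothFn.ext0_eventuallyEq (f := SmoothFn.res h f) (F := f.ext0)
      (fun y => (f.ext0_apply ⟨y, h y.2⟩).symm) x).fderiv_eq]

/-- Evaluation of smooth functions at a point. -/
def SmoothFn.evalAt (x : W) : SmoothFn W →ₐ[ℝ] ℝ where
  toFun f := f x
  map_one' := rfl
  map_mul' _ _ := rfl
  map_zero' := rfl
  map_add' _ _ := rfl
  commutes' _ := rfl

theorem SmoothFn.evalAt_apply (x : W) (f : SmoothFn W) : SmoothFn.evalAt x f = f x := rfl

/-- The coordinate function `x^i`. -/
def coordFn (W : Opens (EuclideanSpace ℝ (Fin p))) (i : Fin p) : SmoothFn W :=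
  SmoothFn.ofContDiffAt (fun x => x i) fun _ _ =>
    (EuclideanSpace.proj i : _ →L[ℝ] ℝ).contDiff.contDiffAt

theorem partialX_coordFn (i j : Fin p) :
    SmoothFn.partialX W i (coordFn W j) = if i = j then 1 else 0 := by
  ext x
  rw [SmoothFn.partialX_apply, (SmoothFn.ext0_eventuallyEq (f := coordFn W j)
    (F := (EuclideanSpace.proj j : EuclideanSpace ℝ (Fin p) →L[ℝ] ℝ)) (fun y => rfl) x).fderiv_eq,
    ContinuousLinearMap.fderiv]
  by_cases h : i = j
  · subst h
    simp
  · simp [h, Ne.symm h]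

/-- Polynomial functions on `W`. -/
def polyFn (W : Opens (EuclideanSpace ℝ (Fin p))) : MvPolynomial (Fin p) ℝ →ₐ[ℝ] SmoothFn W :=
  MvPolynomial.aeval (coordFn W)

@[simp]
theorem polyFn_X (i : Fin p) : polyFn W (MvPolynomial.X i) = coordFn W i :=
  MvPolynomial.aeval_X _ _

theorem partialX_polyFn (i : Fin p) (P : MvPolynomial (Fin p) ℝ) :
    SmoothFn.partialX W i (polyFn W P) = polyFn W (MvPolynomial.pderiv i P) := by
  induction P using MvPolynomial.induction_on with
  | C a =>
    rw [MvPolynomial.pderiv_C, map_zero, MvPolynomial.C_eq_smul_one, map_smul, map_one, map_smul,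
      SmoothFn.partialX_one, smul_zero]
  | add P Q hP hQ => simp only [map_add, hP, hQ]
  | mul_X P j hP =>
    rw [map_mul, SmoothFn.partialX_mul, hP, polyFn_X, partialX_coordFn, Derivation.leibniz,
      MvPolynomial.pderiv_X]
    by_cases h : i = j
    · subst h
      simp [mul_comm, add_comm]
    · simp [h, Ne.symm h, mul_comm]

theorem partialX_pow_polyFn_monomial (i : Fin p) (n : ℕ) (s : Fin p →₀ ℕ) (c : ℝ) :
    (SmoothFn.partialX W i ^ n) (polyFn W (MvPolynomial.monomial s c)) =
      polyFn W (MvPolynomial.monomial (s - Finsupp.single i n) (c * (s i).descFactorial n)) := by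
  induction n with
  | zero => simp
  | succ n ih =>
    rw [pow_succ', Module.End.mul_apply, ih, partialX_polyFn, MvPolynomial.pderiv_monomial,
      tsub_tsub, ← Finsupp.single_add, Nat.descFactorial_succ]
    congr 2
    simp only [Finsupp.coe_tsub, Pi.sub_apply, Finsupp.single_eq_same]
    push_cast
    ring

theorem listProd_partialX_polyFn_monomial (α : Fin p → ℕ) {l : List (Fin p)} (hl : l.Nodup)
    (s : Fin p →₀ ℕ) :
    (l.map fun i => SmoothFn.partialX W i ^ α i).prod (polyFn W (MvPolynomial.monomial s 1)) =
      polyFn W (MvPolynomial.monomial (s - (l.map fun i => Finsupp.single i (α i)).sum)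
        (l.map fun i => ((s i).descFactorial (α i) : ℝ)).prod) := by
  induction l with
  | nil => simp
  | cons i l ih =>
    rw [List.nodup_cons] at hl
    have hi : ((l.map fun i => Finsupp.single i (α i)).sum : Fin p →₀ ℕ) i = 0 := by
      have h1 := hl.1
      clear ih hl
      induction l with
      | nil => rfl
      | cons j l ih =>
        rw [List.mem_cons, not_or] at h1
        simp [ih h1.2, Finsupp.single_eq_of_ne h1.1]
    rw [List.map_cons, List.prod_cons, Module.End.mul_apply, ih hl.2,
      partialX_pow_polyFn_monomial]
    simp only [List.map_cons, List.sum_cons, List.prod_cons, tsub_tsub, Finsupp.coe_tsub,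
      Pi.sub_apply, hi, tsub_zero]
    rw [add_comm, mul_comm]

end Smooth

end Supergeometry

end

noncomputable section

namespace Supergeometry

/-! ### Hadamard's lemma -/

section Hadamard

/-- Smooth dependence of an integral over `[0, 1]` on a parameter. -/
theorem contDiff_intervalIntegral_param {E F : Type u} [NormedAddCommGroup E] [NormedSpace ℝ E]
    [ProperSpace E] [NormedAddCommGroup F] [NormedSpace ℝ F] [CompleteSpace F] (n : ℕ)
    (h : E → ℝ → F) (hh : ContDiff ℝ n (Function.uncurry h)) :
    ContDiff ℝ n fun x => ∫ t in (0 : ℝ)..1, h x t := by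
  induction n generalizing F with
  | zero =>
    rw [Nat.cast_zero, contDiff_zero] at *
    exact intervalIntegral.continuous_parametric_intervalIntegral_of_continuous' hh 0 1
  | succ n ih =>
    -- the partial derivative in the parameter
    set h' : E → ℝ → E →L[ℝ] F := fun x t =>
      (fderiv ℝ (Function.uncurry h) (x, t)).comp (ContinuousLinearMap.inl ℝ E ℝ) with hh'
    have hc' : ContDiff ℝ n (Function.uncurry h') := by
      refine ContDiff.clm_comp (g := fun z => fderiv ℝ (Function.uncurry h) z)
        (f := fun _ => ContinuousLinearMap.inl ℝ E ℝ) ?_ contDiff_const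
      exact hh.fderiv_right (by norm_cast)
    have hd : ∀ x t, HasFDerivAt (fun x => h x t) (h' x t) x := by
      intro x t
      have h1 : HasFDerivAt (Function.uncurry h) (fderiv ℝ (Function.uncurry h) (x, t)) (x, t) :=
        (hh.differentiable (by simp)).differentiableAt.hasFDerivAt
      have h2 : HasFDerivAt (fun x : E => (x, t)) (ContinuousLinearMap.inl ℝ E ℝ) x :=
        hasFDerivAt_prodMk_left x t
      exact h1.comp x h2
    have hcont : Continuous (Function.uncurry h) := hh.continuous
    have hcont' : Continuous (Function.uncurry h') := hc'.continuous
    have key : ∀ x, HasFDerivAt (fun x => ∫ t in (0 : ℝ)..1, h x t)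
        (∫ t in (0 : ℝ)..1, h' x t) x := by
      intro x
      obtain ⟨C, hC⟩ := ((isCompact_closedBall x 1).prod (isCompact_Icc (a := (0 : ℝ)) (b := 1))
        ).exists_bound_of_continuousOn hcont'.continuousOn
      refine intervalIntegral.hasFDerivAt_integral_of_dominated_of_fderiv_le
        (bound := fun _ => C) (s := Metric.ball x 1) (Metric.ball_mem_nhds x one_pos)
        (Filter.Eventually.of_forall fun y => ?_) ?_ ?_ ?_ intervalIntegrable_const ?_
      · exact (hcont.comp (Continuous.prodMk_right y)).aestronglyMeasurable
      · exact (hcont.comp (Continuous.prodMk_right x)).intervalIntegrable _ _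
      · exact (hcont'.comp (Continuous.prodMk_right x)).aestronglyMeasurable
      · refine Filter.Eventually.of_forall fun t ht y hy => ?_
        rw [Set.uIoc_of_le zero_le_one] at ht
        exact hC (y, t) ⟨Metric.ball_subset_closedBall hy, ht.1.le, ht.2⟩
      · exact Filter.Eventually.of_forall fun t _ y _ => hd y t
    rw [Nat.cast_add, Nat.cast_one, contDiff_succ_iff_fderiv]
    refine ⟨fun x => (key x).differentiableAt, by simp, ?_⟩
    rw [show fderiv ℝ (fun x => ∫ t in (0 : ℝ)..1, h x t) = fun x => ∫ t in (0 : ℝ)..1, h' x t from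
      funext fun x => (key x).fderiv]
    exact ih h' hc'

/-- Hadamard's lemma on a vector space, from the fundamental theorem of calculus along segments. -/
theorem exists_contDiff_sub_eq_clm_apply {E : Type u} [NormedAddCommGroup E] [NormedSpace ℝ E]
    [ProperSpace E] {F : Type u} [NormedAddCommGroup F] [NormedSpace ℝ F] [CompleteSpace F]
    (f : E → F) (hf : ContDiff ℝ ∞ f) (y : E) :
    ∃ G : E → E →L[ℝ] F, ContDiff ℝ ∞ G ∧ ∀ x, f x - f y = G x (x - y) := by
  have hf' : ContDiff ℝ ∞ (fderiv ℝ f) := hf.fderiv_right (by simp)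
  have hmap : ContDiff ℝ ∞ (Function.uncurry fun (x : E) (t : ℝ) =>
      fderiv ℝ f (y + t • (x - y))) := by
    refine hf'.comp ?_
    exact contDiff_const.add (contDiff_snd.smul (contDiff_fst.sub contDiff_const))
  refine ⟨fun x => ∫ t in (0 : ℝ)..1, fderiv ℝ f (y + t • (x - y)), ?_, fun x => ?_⟩
  · rw [contDiff_infty]
    exact fun n => contDiff_intervalIntegral_param n _ (hmap.of_le (by exact_mod_cast le_top))
  · have hcont : Continuous fun t : ℝ => fderiv ℝ f (y + t • (x - y)) :=
      hmap.continuous.comp (Continuous.prodMk_right x)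
    rw [ContinuousLinearMap.intervalIntegral_apply (hcont.intervalIntegrable _ _)]
    have hd : ∀ t ∈ Set.uIcc (0 : ℝ) 1, HasDerivAt (fun t : ℝ => f (y + t • (x - y)))
        (fderiv ℝ f (y + t • (x - y)) (x - y)) t := by
      intro t _
      have h1 : HasDerivAt (fun t : ℝ => y + t • (x - y)) (x - y) t := by
        simpa using ((hasDerivAt_id t).smul_const (x - y)).const_add y
      exact ((hf.differentiable (by simp)).differentiableAt.hasFDerivAt).comp_hasDerivAt t h1
    rw [intervalIntegral.integral_eq_sub_of_hasDerivAt hd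
      ((hcont.clm_apply continuous_const).intervalIntegrable _ _)]
    simp

variable {p : ℕ} {W : Opens (EuclideanSpace ℝ (Fin p))}

/-- Hadamard's lemma on an open set `W`, which need not be star-shaped. The remainder `r` vanishes
near `y`, which is expressed by `h * r = r` for a function `h` with `h y = 0`; then `r` lies in
every power of the ideal of functions vanishing at `y`. -/
theorem SmoothFn.exists_hadamard (f : SmoothFn W) (y : W) :
    ∃ (g : Fin p → SmoothFn W) (h r : SmoothFn W), h y = 0 ∧ h * r = r ∧
      f = algebraMap ℝ _ (f y) + ∑ i, (coordFn W i - algebraMap ℝ _ (coordFn W i y)) * g i + r := by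
  obtain ⟨R, hR, hRW⟩ := Metric.isOpen_iff.1 W.isOpen y y.2
  -- `χ f` extends `f` near `y` smoothly to the whole space, and `h = 1 - χ'` with `χ = 1` on the
  -- support of `χ'`, so that `h = 1` wherever `r = f - χ f` does not vanish
  let χ : ContDiffBump (y : EuclideanSpace ℝ (Fin p)) := ⟨R / 4, R / 2, by positivity, by linarith⟩
  let χ' : ContDiffBump (y : EuclideanSpace ℝ (Fin p)) := ⟨R / 8, R / 4, by positivity, by linarith⟩
  have hsub : Metric.closedBall (y : EuclideanSpace ℝ (Fin p)) (R / 2) ⊆ W :=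
    (Metric.closedBall_subset_ball (by linarith)).trans hRW
  set F : EuclideanSpace ℝ (Fin p) → ℝ := fun x => χ x * f.ext0 x with hFdef
  have hF : ContDiff ℝ ∞ F := by
    rw [contDiff_iff_contDiffAt]
    intro x
    by_cases hx : x ∈ Metric.closedBall (y : EuclideanSpace ℝ (Fin p)) (R / 2)
    · exact χ.contDiffAt.mul (f.contDiffAt_ext0 ⟨x, hsub hx⟩)
    · refine (contDiffAt_const (c := (0 : ℝ))).congr_of_eventuallyEq ?_
      filter_upwards [Metric.isClosed_closedBall.isOpen_compl.mem_nhds hx] with z hz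
      have : χ z = 0 := χ.zero_of_le_dist (by
        simp only [Set.mem_compl_iff, Metric.mem_closedBall, not_le] at hz
        exact hz.le)
      simp [hFdef, this]
  obtain ⟨G, hG, hGF⟩ := exists_contDiff_sub_eq_clm_apply F hF y
  have hFy : F y = f y := by
    simp [hFdef, f.ext0_apply y, χ.one_of_mem_closedBall (Metric.mem_closedBall_self χ.rIn_pos.le)]
  refine ⟨fun i => SmoothFn.ofContDiffAt (fun x => G x (EuclideanSpace.single i 1))
      fun x _ => (hG.clm_apply contDiff_const).contDiffAt,
    SmoothFn.ofContDiffAt (fun x => 1 - χ' x) fun x _ => contDiffAt_const.sub χ'.contDiffAt,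
    f - SmoothFn.ofContDiffAt F fun x _ => hF.contDiffAt, ?_, ?_, ?_⟩
  · simp [χ'.one_of_mem_closedBall (Metric.mem_closedBall_self χ'.rIn_pos.le)]
  · ext x
    change (1 - χ' x) * (f x - F x) = f x - F x
    by_cases hx : dist (x : EuclideanSpace ℝ (Fin p)) y ≤ R / 4
    · have : χ x = 1 := χ.one_of_mem_closedBall hx
      simp [hFdef, this, f.ext0_apply x]
    · have : χ' x = 0 := χ'.zero_of_le_dist (not_le.1 hx).le
      simp [this]
  · ext x
    have hsum : G x (x - y) = ∑ i, ((x : EuclideanSpace ℝ (Fin p)) i -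
        (y : EuclideanSpace ℝ (Fin p)) i) * G x (EuclideanSpace.single i 1) := by
      have : (x - y : EuclideanSpace ℝ (Fin p)) = ∑ i, ((x : EuclideanSpace ℝ (Fin p)) i -
        (y : EuclideanSpace ℝ (Fin p)) i) • EuclideanSpace.single i (1 : ℝ) := by
        ext j
        simp [Pi.single_apply]
      rw [this, map_sum]
      simp
    have h1 := hGF x
    rw [hsum, hFy] at h1
    rw [← SmoothFn.evalAt_apply, ← SmoothFn.evalAt_apply]
    simp only [map_add, map_sum, map_mul, map_sub, AlgHom.commutes]
    change f x = f y + ∑ i, ((x : EuclideanSpace ℝ (Fin p)) i -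
        (y : EuclideanSpace ℝ (Fin p)) i) * G x (EuclideanSpace.single i 1) + (f x - F x)
    rw [← h1]
    ring

end Hadamard

end Supergeometry

end

noncomputable section

namespace Supergeometry

/-! ### Superdomains: parity and derivations -/

section Superdomain

variable {p q : ℕ} {W : Opens (EuclideanSpace ℝ (Fin p))}

/-- The parity involution of the Grassmann algebra, `ξ^a ↦ -ξ^a`. -/
abbrev grassmannInvolution (q : ℕ) : Grassmann q →ₐ[ℝ] Grassmann q :=
  CliffordAlgebra.involute (Q := (0 : QuadraticForm ℝ (Fin q → ℝ)))

/-- The parity involution of superfunctions on a superdomain. -/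
def superInvolution (q : ℕ) (W : Opens (EuclideanSpace ℝ (Fin p))) :
    SuperFn q W →ₐ[ℝ] SuperFn q W :=
  Algebra.TensorProduct.map (AlgHom.id ℝ (SmoothFn W)) (grassmannInvolution q)

@[simp]
theorem superInvolution_tmul (g : SmoothFn W) (w : Grassmann q) :
    superInvolution q W (g ⊗ₜ w) = g ⊗ₜ grassmannInvolution q w := rfl

theorem grassmannInvolution_gen (a : Fin q) : grassmannInvolution q (gen a) = -gen a :=
  CliffordAlgebra.involute_ι _

theorem superInvolution_of_mem_parity {i : ZMod 2} {f : SuperFn q W}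
    (hf : f ∈ SuperFn.parity q W i) :
    superInvolution q W f = if i = 0 then f else -f := by
  have hf' : f ∈ (CliffordAlgebra.evenOdd (0 : QuadraticForm ℝ (Fin q → ℝ)) i).baseChange
    (SmoothFn W) := hf
  have hw : ∀ w ∈ CliffordAlgebra.evenOdd (0 : QuadraticForm ℝ (Fin q → ℝ)) i,
      grassmannInvolution q w = if i = 0 then w else -w := by
    intro w hw
    rcases zmod_two_cases i with rfl | rfl
    · rw [if_pos rfl]
      exact CliffordAlgebra.involute_eq_of_mem_even hw
    · rw [if_neg one_ne_zero]
      exact CliffordAlgebra.involute_eq_of_mem_odd hw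
  rw [Submodule.baseChange_eq_span] at hf'
  clear hf
  induction hf' using Submodule.span_induction with
  | mem x hx =>
    obtain ⟨w, hw', rfl⟩ := hx
    simp only [TensorProduct.mk_apply, superInvolution_tmul, hw w hw']
    split_ifs
    · rfl
    · rw [TensorProduct.tmul_neg]
  | zero => simp
  | add x y _ _ hx hy =>
    rw [map_add, hx, hy]
    split_ifs
    · rfl
    · rw [neg_add]
  | smul g x _ hx =>
    have : ∀ x : SuperFn q W, superInvolution q W (g • x) = g • superInvolution q W x := by
      intro x
      induction x using TensorProduct.induction_on with
      | zero => simp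
      | tmul a w =>
        rw [TensorProduct.smul_tmul', superInvolution_tmul, superInvolution_tmul,
          TensorProduct.smul_tmul']
      | add x y hx hy => rw [smul_add, map_add, hx, hy, map_add, smul_add]
    rw [this, hx]
    split_ifs
    · rfl
    · rw [smul_neg]

theorem genDeriv_mul (a : Fin q) (v w : Grassmann q) :
    genDeriv a (v * w) = genDeriv a v * w + grassmannInvolution q v * genDeriv a w := by
  induction v using ExteriorAlgebra.induction generalizing w with
  | algebraMap r =>
    rw [AlgHom.commutes, Algebra.algebraMap_eq_smul_one, smul_mul_assoc, one_mul, map_smul,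
      map_smul, genDeriv_one, smul_zero, zero_mul, zero_add, smul_mul_assoc, one_mul]
  | ι v =>
    have h1 := CliffordAlgebra.contractLeft_ι_mul (Q := (0 : QuadraticForm ℝ (Fin q → ℝ)))
      (LinearMap.proj a) v w
    have h2 := CliffordAlgebra.contractLeft_ι (Q := (0 : QuadraticForm ℝ (Fin q → ℝ)))
      (LinearMap.proj a) v
    have h3 := CliffordAlgebra.involute_ι (Q := (0 : QuadraticForm ℝ (Fin q → ℝ))) v
    refine h1.trans ?_
    change _ = CliffordAlgebra.contractLeft (Q := (0 : QuadraticForm ℝ (Fin q → ℝ)))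
      (LinearMap.proj a) (CliffordAlgebra.ι _ v) * w +
      CliffordAlgebra.involute (CliffordAlgebra.ι _ v) * genDeriv a w
    rw [h2, h3, Algebra.algebraMap_eq_smul_one, smul_mul_assoc, one_mul, neg_mul, sub_eq_add_neg]
    rfl
  | mul v v' hv hv' =>
    rw [mul_assoc, hv, hv', hv, map_mul]
    simp only [mul_add, add_mul, mul_assoc, add_assoc]
  | add v v' hv hv' =>
    simp only [add_mul, map_add, hv, hv']
    abel

theorem genDeriv_involution (a : Fin q) (v : Grassmann q) :
    genDeriv a (grassmannInvolution q v) = -grassmannInvolution q (genDeriv a v) := by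
  induction v using ExteriorAlgebra.induction with
  | algebraMap r =>
    rw [AlgHom.commutes, Algebra.algebraMap_eq_smul_one, map_smul, genDeriv_one]
    simp
  | ι v =>
    have h2 := CliffordAlgebra.contractLeft_ι (Q := (0 : QuadraticForm ℝ (Fin q → ℝ)))
      (LinearMap.proj a) v
    have h3 := CliffordAlgebra.involute_ι (Q := (0 : QuadraticForm ℝ (Fin q → ℝ))) v
    change CliffordAlgebra.contractLeft (Q := (0 : QuadraticForm ℝ (Fin q → ℝ)))
      (LinearMap.proj a) (CliffordAlgebra.involute (CliffordAlgebra.ι _ v)) =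
      -CliffordAlgebra.involute (CliffordAlgebra.contractLeft
        (Q := (0 : QuadraticForm ℝ (Fin q → ℝ))) (LinearMap.proj a) (CliffordAlgebra.ι _ v))
    rw [h3, map_neg, h2, AlgHom.commutes]
  | mul v v' hv hv' =>
    rw [map_mul, genDeriv_mul, genDeriv_mul, hv, hv', map_add, map_mul, map_mul]
    noncomm_ring
  | add v v' hv hv' =>
    simp only [map_add, hv, hv', neg_add]

@[simp]
theorem SuperFn.partialX_tmul (i : Fin p) (g : SmoothFn W) (w : Grassmann q) :
    SuperFn.partialX q W i (g ⊗ₜ w) = SmoothFn.partialX W i g ⊗ₜ w := rfl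

@[simp]
theorem SuperFn.partialXi_tmul (a : Fin q) (g : SmoothFn W) (w : Grassmann q) :
    SuperFn.partialXi q W a (g ⊗ₜ w) = g ⊗ₜ genDeriv a w := rfl

/-- Two bi-additive expressions in superfunctions agree once they agree on pure tensors. -/
theorem SuperFn.induction₂ {motive : SuperFn q W → SuperFn q W → Prop}
    (h0 : ∀ f, motive f 0) (h0' : ∀ f, motive 0 f)
    (ht : ∀ g w g' w', motive (g ⊗ₜ w) (g' ⊗ₜ w'))
    (hadd : ∀ f f' g, motive f g → motive f' g → motive (f + f') g)
    (hadd' : ∀ f g g', motive f g → motive f g' → motive f (g + g')) (f g : SuperFn q W) :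
    motive f g := by
  induction f using TensorProduct.induction_on with
  | zero => exact h0' g
  | add f f' hf hf' => exact hadd _ _ _ hf hf'
  | tmul a w =>
    induction g using TensorProduct.induction_on with
    | zero => exact h0 _
    | add g g' hg hg' => exact hadd' _ _ _ hg hg'
    | tmul b v => exact ht _ _ _ _

theorem SuperFn.isSuperDiffOp_partialX (hσ : IsSuperInvolution (superInvolution q W)) (i : Fin p) :
    IsSuperDiffOp (superInvolution q W) 2 (SuperFn.partialX q W i) := by
  refine IsSuperDiffOp.of_even_derivation hσ (fun f => ?_) (fun f g => ?_)
  · induction f using TensorProduct.induction_on with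
    | zero => simp
    | add f f' hf hf' => simp only [map_add, hf, hf']
    | tmul a w => rfl
  · induction f, g using SuperFn.induction₂ with
    | h0 f => simp
    | h0' f => simp
    | ht g w g' w' =>
      rw [Algebra.TensorProduct.tmul_mul_tmul, partialX_tmul, SmoothFn.partialX_mul,
        partialX_tmul, partialX_tmul, TensorProduct.add_tmul, Algebra.TensorProduct.tmul_mul_tmul,
        Algebra.TensorProduct.tmul_mul_tmul]
    | hadd f f' g hf hf' =>
      simp only [add_mul, map_add, hf, hf']
      abel
    | hadd' f g g' hg hg' =>
      simp only [mul_add, map_add, hg, hg']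
      abel

theorem SuperFn.isSuperDiffOp_partialXi (hσ : IsSuperInvolution (superInvolution q W))
    (a : Fin q) : IsSuperDiffOp (superInvolution q W) 2 (SuperFn.partialXi q W a) := by
  refine IsSuperDiffOp.of_odd_derivation hσ (fun f => ?_) (fun f g => ?_)
  · induction f using TensorProduct.induction_on with
    | zero => simp
    | add f f' hf hf' => simp only [map_add, hf, hf', neg_add]
    | tmul b w =>
      rw [superInvolution_tmul, partialXi_tmul, genDeriv_involution, partialXi_tmul,
        superInvolution_tmul, TensorProduct.tmul_neg]
  · induction f, g using SuperFn.induction₂ with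
    | h0 f => simp
    | h0' f => simp
    | ht g w g' w' =>
      rw [Algebra.TensorProduct.tmul_mul_tmul, partialXi_tmul, genDeriv_mul, superInvolution_tmul,
        partialXi_tmul, partialXi_tmul, TensorProduct.tmul_add, Algebra.TensorProduct.tmul_mul_tmul,
        Algebra.TensorProduct.tmul_mul_tmul]
    | hadd f f' g hf hf' =>
      simp only [add_mul, map_add, hf, hf']
      abel
    | hadd' f g g' hg hg' =>
      simp only [mul_add, map_add, hg, hg']
      abel

theorem SuperFn.isSuperDiffOp_partialMulti (hσ : IsSuperInvolution (superInvolution q W))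
    (α : Fin p → ℕ) (β : Fin q → Fin 2) :
    IsSuperDiffOp (superInvolution q W) (∑ i, α i + ∑ a, (β a : ℕ) + 1)
      (SuperFn.partialMulti q W α β) := by
  have h1 := IsSuperDiffOp.listProd hσ (fun i => SuperFn.partialX q W i ^ α i) α
    (fun i => (isSuperDiffOp_partialX hσ i).pow hσ _) (List.finRange p)
  have h2 := IsSuperDiffOp.listProd hσ (fun a => SuperFn.partialXi q W a ^ (β a : ℕ))
    (fun a => (β a : ℕ)) (fun a => (isSuperDiffOp_partialXi hσ a).pow hσ _)
    (List.finRange q).reverse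
  have h3 := h1.comp hσ h2
  rw [List.map_reverse, List.map_reverse, List.sum_reverse, ← List.ofFn_eq_map,
    ← List.ofFn_eq_map, ← List.ofFn_eq_map, ← List.ofFn_eq_map, List.sum_ofFn, List.sum_ofFn] at h3
  exact h3.mono (by omega)

theorem SuperFn.partialMulti_tmul (α : Fin p → ℕ) (β : Fin q → Fin 2) (g : SmoothFn W)
    (w : Grassmann q) : SuperFn.partialMulti q W α β (g ⊗ₜ w) =
      ((List.finRange p).map fun i => SmoothFn.partialX W i ^ α i).prod g ⊗ₜ
        genDerivMulti (List.finRange q) β w := by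
  have hX : ∀ (l : List (Fin p)) (g : SmoothFn W) (w : Grassmann q),
      (l.map fun i => SuperFn.partialX q W i ^ α i).prod (g ⊗ₜ w) =
        (l.map fun i => SmoothFn.partialX W i ^ α i).prod g ⊗ₜ w := by
    intro l g w
    have hpow : ∀ (i : Fin p) (n : ℕ) (g : SmoothFn W),
        (SuperFn.partialX q W i ^ n) (g ⊗ₜ w) = (SmoothFn.partialX W i ^ n) g ⊗ₜ w := by
      intro i n g
      induction n with
      | zero => rfl
      | succ n ih => rw [pow_succ', pow_succ', Module.End.mul_apply, ih]; rfl
    induction l with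
    | nil => rfl
    | cons i l ih =>
      rw [List.map_cons, List.map_cons, List.prod_cons, List.prod_cons, Module.End.mul_apply, ih,
        hpow, Module.End.mul_apply]
  have hXi : ∀ (l : List (Fin q)) (g : SmoothFn W) (w : Grassmann q),
      (l.map fun a => SuperFn.partialXi q W a ^ (β a : ℕ)).prod (g ⊗ₜ w) =
        g ⊗ₜ (l.map fun a => genDeriv a ^ (β a : ℕ)).prod w := by
    intro l g w
    have hpow : ∀ (a : Fin q) (n : ℕ) (w : Grassmann q),
        (SuperFn.partialXi q W a ^ n) (g ⊗ₜ w) = g ⊗ₜ (genDeriv a ^ n) w := by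
      intro a n w
      induction n with
      | zero => rfl
      | succ n ih => rw [pow_succ', pow_succ', Module.End.mul_apply, ih]; rfl
    induction l with
    | nil => rfl
    | cons i l ih =>
      rw [List.map_cons, List.map_cons, List.prod_cons, List.prod_cons, Module.End.mul_apply, ih,
        hpow, Module.End.mul_apply]
  rw [SuperFn.partialMulti, genDerivMulti, List.ofFn_eq_map, List.ofFn_eq_map, ← List.map_reverse,
    ← List.map_reverse, Module.End.mul_apply, hXi, hX]

theorem SuperFn.partialMulti_res {W' : Opens (EuclideanSpace ℝ (Fin p))} (h : W' ≤ W)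
    (α : Fin p → ℕ) (β : Fin q → Fin 2) (f : SuperFn q W) :
    SuperFn.partialMulti q W' α β (SuperFn.res q h f) =
      SuperFn.res q h (SuperFn.partialMulti q W α β f) := by
  have hpow : ∀ (i : Fin p) (n : ℕ) (g : SmoothFn W),
      (SmoothFn.partialX W' i ^ n) (SmoothFn.res h g) =
        SmoothFn.res h ((SmoothFn.partialX W i ^ n) g) := by
    intro i n g
    induction n with
    | zero => rfl
    | succ n ih =>
      rw [pow_succ', pow_succ', Module.End.mul_apply, ih, SmoothFn.partialX_res]; rfl
  have hX : ∀ (l : List (Fin p)) (g : SmoothFn W),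
      (l.map fun i => SmoothFn.partialX W' i ^ α i).prod (SmoothFn.res h g) =
        SmoothFn.res h ((l.map fun i => SmoothFn.partialX W i ^ α i).prod g) := by
    intro l g
    induction l with
    | nil => rfl
    | cons i l ih =>
      rw [List.map_cons, List.map_cons, List.prod_cons, List.prod_cons, Module.End.mul_apply, ih,
        hpow, Module.End.mul_apply]
  induction f using TensorProduct.induction_on with
  | zero => simp
  | add f f' hf hf' => simp only [map_add, hf, hf']
  | tmul g w =>
    rw [partialMulti_tmul]
    change SuperFn.partialMulti q W' α β (SmoothFn.res h g ⊗ₜ w) = SmoothFn.res h _ ⊗ₜ _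
    rw [partialMulti_tmul, hX]
    rfl

/-! ### Superdomains: operators are determined by their values on monomials -/

/-- The monomial `x^α ξ^β`. -/
def SuperFn.monomial (q : ℕ) (W : Opens (EuclideanSpace ℝ (Fin p))) (α : Fin p →₀ ℕ)
    (β : Fin q → Fin 2) : SuperFn q W :=
  polyFn W (MvPolynomial.monomial α 1) ⊗ₜ genMonomial (List.finRange q) β

/-- The coordinate functions `x^i` and `ξ^a`. -/
def SuperFn.coordinates (q : ℕ) (W : Opens (EuclideanSpace ℝ (Fin p))) : Set (SuperFn q W) :=
  Set.range (fun i => coordFn W i ⊗ₜ 1) ∪ Set.range (fun a => 1 ⊗ₜ gen a)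

theorem SuperFn.superInvolution_of_mem_coordinates {s : SuperFn q W}
    (hs : s ∈ SuperFn.coordinates q W) :
    superInvolution q W s = s ∨ superInvolution q W s = -s := by
  rcases hs with ⟨i, rfl⟩ | ⟨a, rfl⟩
  · left; simp
  · right; simp [grassmannInvolution_gen, TensorProduct.tmul_neg]

/-- Products of `n` coordinate functions are combinations of monomials of degree `≤ n`. -/
theorem SuperFn.listProd_mem_span_monomial (l : List (SuperFn q W))
    (hl : ∀ s ∈ l, s ∈ SuperFn.coordinates q W) :
    l.prod ∈ Submodule.span ℝ {f : SuperFn q W | ∃ (α : Fin p →₀ ℕ) (β : Fin q → Fin 2),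
      ∑ i, α i + ∑ a, (β a : ℕ) ≤ l.length ∧ f = SuperFn.monomial q W α β} := by
  induction l with
  | nil =>
    refine Submodule.subset_span ⟨0, 0, by simp, ?_⟩
    have : genMonomial (List.finRange q) 0 = 1 := by simp [genMonomial]
    rw [SuperFn.monomial, this, List.prod_nil, MvPolynomial.monomial_zero', map_one, map_one]
    rfl
  | cons s l ih =>
    have ih := ih fun s hs => hl s (by simp [hs])
    rw [List.prod_cons]
    have hle : Submodule.span ℝ {f : SuperFn q W | ∃ (α : Fin p →₀ ℕ) (β : Fin q → Fin 2),
        ∑ i, α i + ∑ a, (β a : ℕ) ≤ l.length ∧ f = SuperFn.monomial q W α β} ≤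
        (Submodule.span ℝ {f : SuperFn q W | ∃ (α : Fin p →₀ ℕ) (β : Fin q → Fin 2),
          ∑ i, α i + ∑ a, (β a : ℕ) ≤ (s :: l).length ∧ f = SuperFn.monomial q W α β}).comap
          (LinearMap.mulLeft ℝ s) := by
      rw [Submodule.span_le]
      rintro _ ⟨α, β, hd, rfl⟩
      simp only [Submodule.comap_coe, Set.mem_preimage, LinearMap.mulLeft_apply, SetLike.mem_coe]
      rcases hl s (by simp) with ⟨i, rfl⟩ | ⟨a, rfl⟩
      · refine Submodule.subset_span ⟨Finsupp.single i 1 + α, β, ?_, ?_⟩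
        · simp only [Finsupp.coe_add, Pi.add_apply, Finset.sum_add_distrib, List.length_cons]
          rw [show ∑ x, (Finsupp.single i 1 : Fin p →₀ ℕ) x = 1 by simp [Finsupp.single_apply]]
          omega
        · rw [SuperFn.monomial, SuperFn.monomial, Algebra.TensorProduct.tmul_mul_tmul, one_mul,
            ← polyFn_X, ← map_mul, MvPolynomial.X, MvPolynomial.monomial_mul, one_mul]
      · rw [SuperFn.monomial, Algebra.TensorProduct.tmul_mul_tmul, one_mul]
        rcases fin_two_cases (β a) with h | h
        · obtain ⟨c, hc⟩ := gen_mul_genMonomial_of_zero (List.nodup_finRange q)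
            (List.mem_finRange a) h
          rw [hc, TensorProduct.tmul_smul]
          refine Submodule.smul_mem _ _ (Submodule.subset_span ⟨α, Function.update β a 1, ?_, rfl⟩)
          have : ∑ b, (Function.update β a 1 b : ℕ) = ∑ b, (β b : ℕ) + 1 := by
            rw [← Finset.add_sum_erase _ _ (Finset.mem_univ a),
              ← Finset.add_sum_erase _ (fun b => (β b : ℕ)) (Finset.mem_univ a), h,
              Finset.sum_congr rfl fun b hb => by
                rw [Function.update_of_ne (Finset.ne_of_mem_erase hb)]]
            simp [add_comm]
          rw [this, List.length_cons]
          omega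
        · rw [gen_mul_genMonomial_of_one (List.mem_finRange a) h, TensorProduct.tmul_zero]
          exact zero_mem _
    exact hle ih

/-- An operator of order `≤ k` that kills the monomials of degree `≤ k` kills all polynomials. -/
theorem SuperFn.eq_zero_of_mem_adjoin {k : ℕ} {D : Module.End ℝ (SuperFn q W)}
    (hD : IsSuperDiffOp (superInvolution q W) (k + 1) D)
    (h0 : ∀ (α : Fin p →₀ ℕ) (β : Fin q → Fin 2), ∑ i, α i + ∑ a, (β a : ℕ) ≤ k →
      D (SuperFn.monomial q W α β) = 0) {f : SuperFn q W}
    (hf : f ∈ Algebra.adjoin ℝ (SuperFn.coordinates q W)) : D f = 0 := by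
  have hl := hD.listProd_eq_zero (fun s hs => superInvolution_of_mem_coordinates hs)
    (fun l hl hk => by
      have hle : Submodule.span ℝ {f : SuperFn q W | ∃ (α : Fin p →₀ ℕ) (β : Fin q → Fin 2),
          ∑ i, α i + ∑ a, (β a : ℕ) ≤ l.length ∧ f = SuperFn.monomial q W α β} ≤
          LinearMap.ker D := by
        rw [Submodule.span_le]
        rintro _ ⟨α, β, hd, rfl⟩
        exact h0 α β (by omega)
      exact hle (listProd_mem_span_monomial l hl))
  have hle : Submodule.span ℝ (Submonoid.closure (SuperFn.coordinates q W) : Set (SuperFn q W)) ≤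
      LinearMap.ker D := by
    rw [Submodule.span_le]
    intro f hf
    obtain ⟨l, hl', rfl⟩ := Submonoid.exists_list_of_mem_closure hf
    exact hl l hl'
  rw [← Subalgebra.mem_toSubmodule, Algebra.adjoin_eq_span] at hf
  exact hle hf

/-- Homogeneous generators of the ideal of superfunctions whose body vanishes at `y`. -/
def SuperFn.vanishingGenerators (q : ℕ) (y : W) : Set (SuperFn q W) :=
  (fun g : SmoothFn W => g ⊗ₜ 1) '' {g | g y = 0} ∪ Set.range (fun a => 1 ⊗ₜ gen a)

theorem SuperFn.superInvolution_of_mem_vanishingGenerators {y : W} {s : SuperFn q W}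
    (hs : s ∈ SuperFn.vanishingGenerators q y) :
    superInvolution q W s = s ∨ superInvolution q W s = -s := by
  rcases hs with ⟨i, _, rfl⟩ | ⟨a, rfl⟩
  · left; simp
  · right; simp [grassmannInvolution_gen, TensorProduct.tmul_neg]

/-- Taylor expansion at `y`: a superfunction is a polynomial up to any power of the ideal of
superfunctions whose body vanishes at `y`. -/
theorem SuperFn.mem_adjoin_sup_powFiltration (y : W) (N : ℕ) (f : SuperFn q W) :
    f ∈ Subalgebra.toSubmodule (Algebra.adjoin ℝ (SuperFn.coordinates q W)) ⊔
      powFiltration (SuperFn.vanishingGenerators q y) N := by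
  have hsmooth : ∀ (N : ℕ) (g : SmoothFn W), (g ⊗ₜ 1 : SuperFn q W) ∈
      Subalgebra.toSubmodule (Algebra.adjoin ℝ (SuperFn.coordinates q W)) ⊔
        powFiltration (SuperFn.vanishingGenerators q y) N := by
    intro N
    induction N with
    | zero => exact fun g => Submodule.mem_sup_right trivial
    | succ N ih =>
      intro g
      obtain ⟨g', h, r, hh, hr, hg⟩ := g.exists_hadamard y
      have hx : ∀ i, ((coordFn W i - algebraMap ℝ _ (coordFn W i y)) ⊗ₜ 1 : SuperFn q W) ∈
          Algebra.adjoin ℝ (SuperFn.coordinates q W) := by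
        intro i
        rw [TensorProduct.sub_tmul]
        exact sub_mem (Algebra.subset_adjoin (Or.inl ⟨i, rfl⟩)) (Subalgebra.algebraMap_mem _ _)
      have hr' : ∀ n, (r ⊗ₜ 1 : SuperFn q W) ∈
          powFiltration (SuperFn.vanishingGenerators q y) n := by
        intro n
        induction n with
        | zero => trivial
        | succ n ih =>
          rw [show (r ⊗ₜ 1 : SuperFn q W) = (h ⊗ₜ 1) * (r ⊗ₜ 1) by
            rw [Algebra.TensorProduct.tmul_mul_tmul, hr, mul_one]]
          exact mul_mem_powFiltration_succ (Or.inl ⟨h, hh, rfl⟩) ih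
      rw [hg, TensorProduct.add_tmul, TensorProduct.add_tmul, TensorProduct.sum_tmul]
      refine add_mem (add_mem (Submodule.mem_sup_left (Subalgebra.algebraMap_mem _ _))
        (Submodule.sum_mem _ fun i _ => ?_)) (Submodule.mem_sup_right (hr' _))
      obtain ⟨a, ha, m, hm, ham⟩ := Submodule.mem_sup.1 (ih (g' i))
      rw [show (((coordFn W i - algebraMap ℝ _ (coordFn W i y)) * g' i) ⊗ₜ 1 : SuperFn q W) =
        ((coordFn W i - algebraMap ℝ _ (coordFn W i y)) ⊗ₜ 1) * (g' i ⊗ₜ 1) by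
          rw [Algebra.TensorProduct.tmul_mul_tmul, mul_one], ← ham, mul_add]
      refine Submodule.add_mem_sup (Subalgebra.mul_mem _ (hx i) ha)
        (mul_mem_powFiltration_succ ?_ hm)
      refine Or.inl ⟨_, ?_, rfl⟩
      change coordFn W i y - coordFn W i y = 0
      exact sub_self _
  induction f using TensorProduct.induction_on with
  | zero => exact zero_mem _
  | add f f' hf hf' => exact add_mem hf hf'
  | tmul g w =>
    have hw : (1 ⊗ₜ w : SuperFn q W) ∈ Algebra.adjoin ℝ (SuperFn.coordinates q W) := by
      have h1 : w ∈ Algebra.adjoin ℝ (Set.range (gen (q := q))) := by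
        rw [adjoin_range_gen]; trivial
      have h2 : Algebra.adjoin ℝ (Set.range (gen (q := q))) ≤
          (Algebra.adjoin ℝ (SuperFn.coordinates q W)).comap
            (Algebra.TensorProduct.includeRight : Grassmann q →ₐ[ℝ] SuperFn q W) := by
        rw [Algebra.adjoin_le_iff]
        rintro _ ⟨a, rfl⟩
        exact Algebra.subset_adjoin (Or.inr ⟨a, rfl⟩)
      exact h2 h1
    obtain ⟨a, ha, m, hm, ham⟩ := Submodule.mem_sup.1 (hsmooth N g)
    rw [show (g ⊗ₜ w : SuperFn q W) = (g ⊗ₜ 1) * (1 ⊗ₜ w) by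
      rw [Algebra.TensorProduct.tmul_mul_tmul, mul_one, one_mul], ← ham, add_mul]
    exact Submodule.add_mem_sup (Subalgebra.mul_mem _ ha hw) (powFiltration_mul_mem hm _)

/-- Evaluation of the coefficients of a superfunction at a point. -/
def SuperFn.evalAt (q : ℕ) (y : W) : SuperFn q W →ₐ[ℝ] Grassmann q :=
  (Algebra.TensorProduct.lid ℝ (Grassmann q)).toAlgHom.comp
    (Algebra.TensorProduct.map (SmoothFn.evalAt y) (AlgHom.id ℝ (Grassmann q)))

theorem SuperFn.evalAt_tmul (y : W) (g : SmoothFn W) (w : Grassmann q) :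
    SuperFn.evalAt q y (g ⊗ₜ w) = g y • w := rfl

theorem SuperFn.eq_zero_of_evalAt {f : SuperFn q W} (hf : ∀ y : W, SuperFn.evalAt q y f = 0) :
    f = 0 := by
  let b := Module.Free.chooseBasis ℝ (Grassmann q)
  have key : ∀ (f : SuperFn q W) (y : W) j, b.repr (SuperFn.evalAt q y f) j =
      TensorProduct.equivFinsuppOfBasisRight (M := SmoothFn W) b f j y := by
    intro f y j
    induction f using TensorProduct.induction_on with
    | zero => simp
    | add f f' hf hf' => simp [map_add, hf, hf']
    | tmul g w => simp [SuperFn.evalAt_tmul, mul_comm]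
  apply (TensorProduct.equivFinsuppOfBasisRight (M := SmoothFn W) b).injective
  rw [map_zero]
  ext j y
  rw [← key, hf]
  simp

/-- The span of the monomials `ξ^β` with `|β| ≥ n`. -/
def highDegree (q n : ℕ) : Submodule ℝ (Grassmann q) :=
  Submodule.span ℝ {w | ∃ β : Fin q → Fin 2, n ≤ ∑ a, (β a : ℕ) ∧
    w = genMonomial (List.finRange q) β}

theorem gen_mul_mem_highDegree {n : ℕ} (a : Fin q) {w : Grassmann q} (hw : w ∈ highDegree q n) :
    gen a * w ∈ highDegree q (n + 1) := by
  have hle : highDegree q n ≤ (highDegree q (n + 1)).comap (LinearMap.mulLeft ℝ (gen a)) := by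
    rw [highDegree, Submodule.span_le]
    rintro _ ⟨β, hβ, rfl⟩
    simp only [Submodule.comap_coe, Set.mem_preimage, LinearMap.mulLeft_apply, SetLike.mem_coe]
    rcases fin_two_cases (β a) with h | h
    · obtain ⟨c, hc⟩ := gen_mul_genMonomial_of_zero (List.nodup_finRange q)
        (List.mem_finRange a) h
      rw [hc]
      refine Submodule.smul_mem _ _ (Submodule.subset_span ⟨Function.update β a 1, ?_, rfl⟩)
      have : ∑ b, (Function.update β a 1 b : ℕ) = ∑ b, (β b : ℕ) + 1 := by
        rw [← Finset.add_sum_erase _ _ (Finset.mem_univ a),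
          ← Finset.add_sum_erase _ (fun b => (β b : ℕ)) (Finset.mem_univ a), h,
          Finset.sum_congr rfl fun b hb => by
            rw [Function.update_of_ne (Finset.ne_of_mem_erase hb)]]
        simp [add_comm]
      omega
    · rw [gen_mul_genMonomial_of_one (List.mem_finRange a) h]
      exact zero_mem _
  exact hle hw

theorem highDegree_zero : highDegree q 0 = ⊤ := by
  have hmul : ∀ v : Grassmann q, ∀ w ∈ highDegree q 0, v * w ∈ highDegree q 0 := by
    intro v
    have hv : v ∈ Algebra.adjoin ℝ (Set.range (gen (q := q))) := by
      rw [adjoin_range_gen]; trivial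
    induction hv using Algebra.adjoin_induction with
    | mem x hx =>
      obtain ⟨a, rfl⟩ := hx
      intro w hw
      refine Submodule.span_mono ?_ (gen_mul_mem_highDegree a hw)
      rintro _ ⟨β, _, rfl⟩
      exact ⟨β, Nat.zero_le _, rfl⟩
    | algebraMap r =>
      intro w hw
      rw [← Algebra.smul_def]
      exact Submodule.smul_mem _ _ hw
    | add x y _ _ hx hy =>
      intro w hw
      rw [add_mul]
      exact add_mem (hx w hw) (hy w hw)
    | mul x y _ _ hx hy =>
      intro w hw
      rw [mul_assoc]
      exact hx _ (hy w hw)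
  rw [eq_top_iff]
  intro w _
  rw [← mul_one w]
  refine hmul w 1 (Submodule.subset_span ⟨0, Nat.zero_le _, ?_⟩)
  simp [genMonomial]

theorem highDegree_eq_bot {n : ℕ} (hn : q < n) : highDegree q n = ⊥ := by
  rw [highDegree, Submodule.span_eq_bot]
  rintro _ ⟨β, hβ, rfl⟩
  have : ∑ a, (β a : ℕ) ≤ ∑ _a : Fin q, 1 := Finset.sum_le_sum fun a _ => by omega
  rw [Finset.sum_const, Finset.card_univ, Fintype.card_fin, smul_eq_mul, mul_one] at this
  omega

/-- Evaluation at `y` kills the even generators, so that only products of `n` of the `ξ^a`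
survive. -/
theorem SuperFn.evalAt_mem_highDegree (y : W) (n : ℕ) {f : SuperFn q W}
    (hf : f ∈ powFiltration (SuperFn.vanishingGenerators q y) n) :
    SuperFn.evalAt q y f ∈ highDegree q n := by
  induction n generalizing f with
  | zero =>
    rw [highDegree_zero]
    trivial
  | succ n ih =>
    have hle : powFiltration (SuperFn.vanishingGenerators q y) (n + 1) ≤
        (highDegree q (n + 1)).comap (SuperFn.evalAt q y).toLinearMap := by
      rw [powFiltration_succ_le]
      rintro s hs m hm
      simp only [Submodule.mem_comap, AlgHom.toLinearMap_apply, map_mul]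
      rcases hs with ⟨g, hg, rfl⟩ | ⟨a, rfl⟩
      · have hg : g y = 0 := hg
        simp only [SuperFn.evalAt_tmul, hg, zero_smul, zero_mul]
        exact zero_mem _
      · have : SuperFn.evalAt q y ((1 : SmoothFn W) ⊗ₜ gen a) = gen a := by
          rw [SuperFn.evalAt_tmul]
          exact one_smul _ _
        simp only [this]
        exact gen_mul_mem_highDegree a (ih hm)
    exact hle hf

/-- An operator of order `≤ k` on a superdomain that kills the monomials of degree `≤ k` is zero:
up to a polynomial, which it kills, a superfunction lies in such a high power of the ideal at `y`
that all coefficients of its image vanish at `y`. -/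
theorem SuperFn.eq_zero_of_monomial {k : ℕ} {D : Module.End ℝ (SuperFn q W)}
    (hD : IsSuperDiffOp (superInvolution q W) (k + 1) D)
    (h0 : ∀ (α : Fin p →₀ ℕ) (β : Fin q → Fin 2), ∑ i, α i + ∑ a, (β a : ℕ) ≤ k →
      D (SuperFn.monomial q W α β) = 0) : D = 0 := by
  refine LinearMap.ext fun f => ?_
  refine eq_zero_of_evalAt fun y => ?_
  obtain ⟨a, ha, m, hm, rfl⟩ :=
    Submodule.mem_sup.1 (SuperFn.mem_adjoin_sup_powFiltration y (q + (k + 1)) f)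
  rw [map_add, eq_zero_of_mem_adjoin hD h0 ha, zero_add]
  have h1 := hD.map_powFiltration (fun s hs => superInvolution_of_mem_vanishingGenerators hs) q hm
  have h2 := SuperFn.evalAt_mem_highDegree y (q + 1) h1
  rwa [highDegree_eq_bot (Nat.lt_succ_self q), Submodule.mem_bot] at h2

/-! ### Superdomains: the basis of partial derivatives -/

/-- The diagonal entries of the action of the operators on monomials are `α!`; no sign arises, as
the odd derivatives are taken in the order opposite to that of the `ξ^a` in the monomial. -/
theorem SuperFn.partialMulti_monomial_self (α : Fin p → ℕ) (β : Fin q → Fin 2) :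
    ∃ c : ℝ, c ≠ 0 ∧ SuperFn.partialMulti q W α β
      (SuperFn.monomial q W (Finsupp.equivFunOnFinite.symm α) β) = algebraMap ℝ _ c := by
  refine ⟨((List.finRange p).map fun i => ((α i).descFactorial (α i) : ℝ)).prod, ?_, ?_⟩
  · rw [← List.ofFn_eq_map, List.prod_ofFn, Finset.prod_ne_zero_iff]
    intro i _
    rw [Nat.descFactorial_self]
    exact_mod_cast (Nat.factorial_pos _).ne'
  · rw [SuperFn.monomial, SuperFn.partialMulti_tmul,
      listProd_partialX_polyFn_monomial α (List.nodup_finRange p),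
      genDerivMulti_genMonomial_self (List.nodup_finRange q)]
    have : ((List.finRange p).map fun i => Finsupp.single i (α i)).sum =
        Finsupp.equivFunOnFinite.symm α := by
      rw [← List.ofFn_eq_map, List.sum_ofFn]
      ext i
      simp [Finsupp.finsetSum_apply, Finsupp.single_apply]
    rw [this, tsub_self, MvPolynomial.monomial_zero', polyFn, MvPolynomial.algHom_C]
    rfl

/-- Triangularity: an operator kills all monomials of at most its own degree but one. -/
theorem SuperFn.partialMulti_monomial_eq_zero {α : Fin p → ℕ} {β : Fin q → Fin 2}
    {α' : Fin p → ℕ} {β' : Fin q → Fin 2}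
    (hd : ∑ i, α' i + ∑ a, (β' a : ℕ) ≤ ∑ i, α i + ∑ a, (β a : ℕ)) (hne : (α, β) ≠ (α', β')) :
    SuperFn.partialMulti q W α β
      (SuperFn.monomial q W (Finsupp.equivFunOnFinite.symm α') β') = 0 := by
  rw [SuperFn.monomial, SuperFn.partialMulti_tmul]
  by_cases h1 : ∃ i, α' i < α i
  · obtain ⟨i, hi⟩ := h1
    have : ((List.finRange p).map fun i =>
        ((Finsupp.equivFunOnFinite.symm α' i).descFactorial (α i) : ℝ)).prod = 0 := by
      rw [← List.ofFn_eq_map, List.prod_ofFn]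
      refine Finset.prod_eq_zero (Finset.mem_univ i) ?_
      exact_mod_cast Nat.descFactorial_of_lt hi
    rw [listProd_partialX_polyFn_monomial α (List.nodup_finRange p), this,
      MvPolynomial.monomial_zero, map_zero, TensorProduct.zero_tmul]
  by_cases h2 : ∃ a, β a = 1 ∧ β' a = 0
  · obtain ⟨a, ha, ha'⟩ := h2
    rw [genDerivMulti_genMonomial_eq_zero (List.nodup_finRange q) (List.mem_finRange a) ha ha',
      TensorProduct.tmul_zero]
  exfalso
  push Not at h1 h2
  have hβ : ∀ a, (β a : ℕ) ≤ β' a := by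
    intro a
    rcases fin_two_cases (β a) with h | h
    · simp [h]
    · rcases fin_two_cases (β' a) with h' | h'
      · exact absurd h' (h2 a h)
      · rw [h, h']
  have hs1 := Finset.sum_le_sum fun i (_ : i ∈ Finset.univ) => h1 i
  have hs2 := Finset.sum_le_sum fun a (_ : a ∈ Finset.univ) => hβ a
  have e1 := (Finset.sum_eq_sum_iff_of_le fun i (_ : i ∈ Finset.univ) => h1 i).1 (by omega)
  have e2 := (Finset.sum_eq_sum_iff_of_le fun a (_ : a ∈ Finset.univ) => hβ a).1 (by omega)
  exact hne (Prod.ext (funext fun i => e1 i (Finset.mem_univ i))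
    (funext fun a => Fin.ext (e2 a (Finset.mem_univ a))))

instance (p q k : ℕ) : Finite (MultiIndex p q k) := by
  refine Finite.of_injective (β := (Fin p → Fin (k + 1)) × (Fin q → Fin 2))
    (fun γ => (fun i => ⟨γ.1.1 i, ?_⟩, γ.1.2)) ?_
  · have := Finset.single_le_sum (f := γ.1.1) (fun _ _ => Nat.zero_le _) (Finset.mem_univ i)
    have := γ.2
    omega
  · intro γ γ' h
    rw [Prod.mk.injEq] at h
    refine Subtype.ext (Prod.ext (funext fun i => ?_) h.2)
    simpa using congrFun h.1 i

/-- The operators `∂_x^α ∂_ξ^β` with `|α| + |β| ≤ k` form a basis of the operators of order `≤ k`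
on any superalgebra isomorphic to that of a superdomain. -/
theorem exists_basis_partialMulti {A : Type*} [Ring A] [Algebra ℝ A] {σ : A →ₐ[ℝ] A}
    (hσ : IsSuperInvolution σ) (e : A ≃ₐ[ℝ] SuperFn q W)
    (he : ∀ f, e (σ f) = superInvolution q W (e f)) (k : ℕ) (N : Submodule A (Module.End ℝ A))
    (hN : ∀ D, D ∈ N ↔ IsSuperDiffOp σ (k + 1) D) :
    ∃ b : Module.Basis (MultiIndex p q k) A N, ∀ γ, (b γ : Module.End ℝ A) =
      e.symm.toLinearMap ∘ₗ SuperFn.partialMulti q W γ.1.1 γ.1.2 ∘ₗ e.toLinearMap := by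
  have hτ := hσ.conj e he
  have he' : ∀ f, e.symm (superInvolution q W f) = σ (e.symm f) := fun f => by
    rw [AlgEquiv.symm_apply_eq, he, AlgEquiv.apply_symm_apply]
  have hmem : ∀ γ : MultiIndex p q k, e.symm.toLinearMap ∘ₗ
      SuperFn.partialMulti q W γ.1.1 γ.1.2 ∘ₗ e.toLinearMap ∈ N := by
    intro γ
    rw [hN]
    refine IsSuperDiffOp.conj e.symm he' (fun f => ?_)
      ((SuperFn.isSuperDiffOp_partialMulti hτ γ.1.1 γ.1.2).mono (Nat.succ_le_succ γ.2))
    simp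
  obtain ⟨b, hb⟩ := exists_basis_of_triangular N (fun γ => ⟨_, hmem γ⟩)
    (fun γ => e.symm (SuperFn.monomial q W (Finsupp.equivFunOnFinite.symm γ.1.1) γ.1.2))
    (fun γ => ∑ i, γ.1.1 i + ∑ a, (γ.1.2 a : ℕ))
    (fun γ => by
      obtain ⟨c, hc, h⟩ := SuperFn.partialMulti_monomial_self (W := W) γ.1.1 γ.1.2
      simp only [LinearMap.comp_apply, AlgEquiv.toLinearMap_apply, AlgEquiv.apply_symm_apply, h,
        AlgEquiv.commutes]
      exact (IsUnit.mk0 c hc).map (algebraMap ℝ A))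
    (fun γ γ' hd hne => by
      simp only [LinearMap.comp_apply, AlgEquiv.toLinearMap_apply, AlgEquiv.apply_symm_apply]
      rw [SuperFn.partialMulti_monomial_eq_zero hd fun h => hne (Subtype.ext h), map_zero])
    (fun D hD h0 => by
      have h1 : e.toLinearMap ∘ₗ D ∘ₗ e.symm.toLinearMap = 0 := by
        refine SuperFn.eq_zero_of_monomial (k := k)
          (IsSuperDiffOp.conj e he (fun f => by simp) ((hN D).1 hD)) fun α β hd => ?_
        have := h0 ⟨(α, β), hd⟩
        simp only [Finsupp.equivFunOnFinite_symm_coe] at this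
        simp [this]
      ext f
      have := LinearMap.congr_fun h1 (e f)
      simpa using this)
  exact ⟨b, fun γ => by rw [hb]⟩

end Superdomain

end Supergeometry

end

noncomputable section

namespace Supergeometry

/-! ### Sections of supermanifolds: gluing and bump functions -/

namespace SuperSheaf

variable {M : TopCat.{u}} (𝒜 : SuperSheaf M)

theorem res_self {U : Opens M} (f : 𝒜.Sections U) : 𝒜.res le_rfl f = f :=
  congrArg (fun φ : 𝒜.sheaf.obj.obj (op U) ⟶ 𝒜.sheaf.obj.obj (op U) =>
    AlgCat.Hom.hom φ f) (𝒜.sheaf.obj.map_id (op U))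

theorem res_res {U V W : Opens M} (h : V ≤ U) (h' : W ≤ V) (f : 𝒜.Sections U) :
    𝒜.res h' (𝒜.res h f) = 𝒜.res (h'.trans h) f :=
  (congrArg (fun φ : 𝒜.sheaf.obj.obj (op U) ⟶ 𝒜.sheaf.obj.obj (op W) =>
    AlgCat.Hom.hom φ f)
    (𝒜.sheaf.obj.map_comp (homOfLE h).op (homOfLE h').op)).symm

theorem eq_of_locally {U : Opens M} {f g : 𝒜.Sections U}
    (h : ∀ m ∈ U, ∃ (W : Opens M) (hW : W ≤ U), m ∈ W ∧ 𝒜.res hW f = 𝒜.res hW g) : f = g := by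
  choose W hW hm he using h
  refine 𝒜.sheaf.eq_of_locally_eq' (fun m : U => W m m.2) U (fun m => homOfLE (hW m m.2))
    (fun m hmU => ?_) f g (fun m => he m m.2)
  exact Opens.mem_iSup.2 ⟨⟨m, hmU⟩, hm m hmU⟩

theorem exists_glue {ι : Type*} {U : Opens M} (W : ι → Opens M) (hW : ∀ i, W i ≤ U)
    (hcover : ∀ m ∈ U, ∃ i, m ∈ W i) (s : ∀ i, 𝒜.Sections (W i))
    (hs : ∀ i j (T : Opens M) (hi : T ≤ W i) (hj : T ≤ W j), 𝒜.res hi (s i) = 𝒜.res hj (s j)) :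
    ∃ f : 𝒜.Sections U, ∀ i, 𝒜.res (hW i) f = s i := by
  obtain ⟨f, hf, -⟩ := 𝒜.sheaf.existsUnique_gluing' W U (fun i => homOfLE (hW i))
    (fun m hm => Opens.mem_iSup.2 (hcover m hm)) s
    (fun i j => hs i j (W i ⊓ W j) inf_le_left inf_le_right)
  exact ⟨f, hf⟩

/-- Gluing of two sections. -/
theorem exists_glue₂ {U V V' : Opens M} (hV : V ≤ U) (hV' : V' ≤ U)
    (hcover : ∀ m ∈ U, m ∈ V ∨ m ∈ V') (s : 𝒜.Sections V) (s' : 𝒜.Sections V')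
    (hs : ∀ (T : Opens M) (h : T ≤ V) (h' : T ≤ V'), 𝒜.res h s = 𝒜.res h' s') :
    ∃ f : 𝒜.Sections U, 𝒜.res hV f = s ∧ 𝒜.res hV' f = s' := by
  obtain ⟨f, hf⟩ := 𝒜.exists_glue (U := U) (fun b : Bool => bif b then V else V')
    (by rintro (_ | _); exacts [hV', hV])
    (fun m hm => (hcover m hm).elim (fun h => ⟨true, h⟩) (fun h => ⟨false, h⟩))
    (fun b => match b with | true => s | false => s')
    (by
      rintro (_ | _) (_ | _) T hi hj
      · rfl
      · exact (hs T hj hi).symm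
      · exact hs T hi hj
      · rfl)
  exact ⟨f, hf true, hf false⟩

/-- The parity involution of `𝒜(U)`. -/
def parityInv (U : Opens M) : 𝒜.Sections U →ₐ[ℝ] 𝒜.Sections U :=
  parityInvolution (𝒜.parity U)

theorem isSuperInvolution (U : Opens M) : IsSuperInvolution (𝒜.parityInv U) :=
  isSuperInvolution_parityInvolution _ (𝒜.supercomm U)

theorem mem_diffOp_iff {k : ℕ} {U : Opens M} {D : Module.End ℝ (𝒜.Sections U)} :
    D ∈ 𝒜.diffOp k U ↔ IsSuperDiffOp (𝒜.parityInv U) (k + 1) D :=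
  mem_diffOps_iff _ _ k D

theorem res_parityInv {U V : Opens M} (h : V ≤ U) (f : 𝒜.Sections U) :
    𝒜.res h (𝒜.parityInv U f) = 𝒜.parityInv V (𝒜.res h f) := by
  have h0 : 𝒜.res h (GradedAlgebra.proj (𝒜.parity U) 0 f) ∈ 𝒜.parity V 0 :=
    𝒜.map_mem h 0 _ (proj_mem _ _ _)
  have h1 : 𝒜.res h (GradedAlgebra.proj (𝒜.parity U) 1 f) ∈ 𝒜.parity V 1 :=
    𝒜.map_mem h 1 _ (proj_mem _ _ _)
  rw [parityInv, parityInv, parityInvolution_apply, map_sub]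
  nth_rw 3 [← proj_zero_add_proj_one (𝒜.parity U) f]
  rw [map_add, map_add, parityInvolution_of_mem_zero _ h0, parityInvolution_of_mem_one _ h1,
    sub_eq_add_neg]

end SuperSheaf

variable {M : TopCat.{u}} {𝒜 : SuperSheaf M} {p q : ℕ}

theorem SuperChart.iso_parityInv {U : Opens M} (c : SuperChart 𝒜 p q U) (V : Opens M) (h : V ≤ U)
    (f : 𝒜.Sections V) :
    c.iso V h (𝒜.parityInv V f) = superInvolution q (bodyImage c.toBody V) (c.iso V h f) := by
  have h0 := c.iso_parity V h 0 _ (proj_mem (𝒜.parity V) 0 f)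
  have h1 := c.iso_parity V h 1 _ (proj_mem (𝒜.parity V) 1 f)
  rw [SuperSheaf.parityInv, parityInvolution_apply, map_sub]
  nth_rw 3 [← proj_zero_add_proj_one (𝒜.parity V) f]
  rw [map_add, map_add, superInvolution_of_mem_parity h0, superInvolution_of_mem_parity h1,
    if_pos rfl, if_neg one_ne_zero, sub_eq_add_neg]

/-- Even bump functions: near `m` the section `χ` is `1`, and it vanishes outside a closed subset
of `V`. Closedness of compact sets, hence the Hausdorff property, is what allows a bump function
in a chart to be extended by zero. -/
theorem IsSupermanifold.exists_bump (h𝒜 : IsSupermanifold 𝒜 p q) {V : Opens M} {m : M}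
    (hm : m ∈ V) : ∃ (χ : 𝒜.Sections ⊤) (W W' : Opens M), m ∈ W ∧ W ≤ V ∧ (∀ x, x ∈ V ∨ x ∈ W') ∧
      𝒜.parityInv ⊤ χ = χ ∧ 𝒜.res (le_top : W ≤ ⊤) χ = 1 ∧ 𝒜.res (le_top : W' ≤ ⊤) χ = 0 := by
  have := h𝒜.t2
  obtain ⟨U, hmU, ⟨c⟩⟩ := h𝒜.exists_chart m
  have hsrc : ∀ {x}, x ∈ c.toBody.source ↔ x ∈ U := fun {x} => by rw [c.source_eq]; rfl
  have hy : c.toBody m ∈ bodyImage c.toBody (V ⊓ U) := by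
    refine ⟨c.toBody.map_source (hsrc.2 hmU), ?_⟩
    change c.toBody.symm (c.toBody m) ∈ V ⊓ U
    rw [c.toBody.left_inv (hsrc.2 hmU)]
    exact ⟨hm, hmU⟩
  obtain ⟨R, hR, hRsub⟩ := Metric.isOpen_iff.1 (bodyImage c.toBody (V ⊓ U)).isOpen _ hy
  let b : ContDiffBump (c.toBody m) := ⟨R / 4, R / 2, by positivity, by linarith⟩
  have hball : Metric.closedBall (c.toBody m) (R / 2) ⊆ bodyImage c.toBody (V ⊓ U) :=
    (Metric.closedBall_subset_ball (by linarith)).trans hRsub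
  have hK : IsCompact (c.toBody.symm '' Metric.closedBall (c.toBody m) (R / 2)) :=
    (isCompact_closedBall _ _).image_of_continuousOn
      (c.toBody.continuousOn_symm.mono fun x hx => (hball hx).1)
  set W' : Opens M := ⟨_, hK.isClosed.isOpen_compl⟩ with hW'
  set W : Opens M := ⟨_, c.toBody.isOpen_inter_preimage
    (Metric.isOpen_ball (x := c.toBody m) (ε := R / 4))⟩ with hW
  have hWU : W ≤ U := fun x hx => hsrc.1 hx.1
  have hcov : ∀ x, x ∈ V ⊓ U ∨ x ∈ W' := by
    intro x
    by_cases hx : x ∈ W'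
    · exact Or.inr hx
    · left
      have hx : ¬ x ∉ c.toBody.symm '' Metric.closedBall (c.toBody m) (R / 2) := hx
      rw [not_not] at hx
      obtain ⟨z, hz, rfl⟩ := hx
      exact (hball hz).2
  -- the bump function in the chart
  set χ₀ : 𝒜.Sections U := (c.iso U le_rfl).symm
    (SmoothFn.ofContDiffAt (fun x => b x) (fun x _ => b.contDiffAt) ⊗ₜ 1) with hχ₀
  have hres : ∀ (T : Opens M) (hT : T ≤ U) (r : ℝ),
      (∀ z ∈ bodyImage c.toBody T, b z = r) → 𝒜.res hT χ₀ = algebraMap ℝ _ r := by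
    intro T hT r hr
    apply (c.iso T hT).injective
    rw [c.iso_res U T le_rfl hT, hχ₀, AlgEquiv.apply_symm_apply, AlgEquiv.commutes]
    change SmoothFn.res (bodyImage_mono c.toBody hT) _ ⊗ₜ 1 = algebraMap ℝ _ r ⊗ₜ 1
    congr 1
    ext z
    exact hr z z.2
  have hzero : ∀ (T : Opens M) (hT : T ≤ U) (_ : T ≤ W'), 𝒜.res hT χ₀ = 0 := by
    intro T hT hT'
    rw [hres T hT 0, map_zero]
    intro z hz
    refine b.zero_of_le_dist (not_lt.1 fun hlt => ?_)
    exact hT' hz.2 ⟨z, hlt.le, rfl⟩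
  obtain ⟨χ, hχU, hχW'⟩ := 𝒜.exists_glue₂ (U := ⊤) (V := U) (V' := W') le_top le_top
    (fun x _ => (hcov x).imp And.right id) χ₀ 0
    (fun T h h' => by rw [hzero T h h', map_zero])
  refine ⟨χ, W, W', ⟨hsrc.2 hmU, Metric.mem_ball_self (by positivity)⟩, ?_,
    fun x => (hcov x).imp And.left id, ?_, ?_, hχW'⟩
  · intro x hx
    have h1 := hball (Metric.ball_subset_closedBall
      (Metric.ball_subset_ball (by linarith) hx.2 : c.toBody x ∈ Metric.ball _ (R / 2)))
    have h2 : c.toBody.symm (c.toBody x) ∈ V ⊓ U := h1.2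
    rw [c.toBody.left_inv hx.1] at h2
    exact h2.1
  · refine 𝒜.eq_of_locally fun x _ => ?_
    rcases hcov x with hx | hx
    · refine ⟨U, le_top, hx.2, ?_⟩
      rw [𝒜.res_parityInv, hχU]
      apply (c.iso U le_rfl).injective
      rw [c.iso_parityInv, hχ₀, AlgEquiv.apply_symm_apply, superInvolution_tmul, map_one]
    · exact ⟨W', le_top, hx, by rw [𝒜.res_parityInv, hχW', map_zero]⟩
  · rw [← 𝒜.res_res le_top hWU, hχU, hres W hWU 1, map_one]
    intro z hz
    have hz2 : c.toBody (c.toBody.symm z) ∈ Metric.ball (c.toBody m) (R / 4) := hz.2.2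
    rw [c.toBody.right_inv hz.1] at hz2
    exact b.one_of_mem_closedBall (Metric.ball_subset_closedBall hz2)

/-- Every germ of a section over `V` is the germ of a section over `U ⊇ V`. -/
theorem IsSupermanifold.exists_extension (h𝒜 : IsSupermanifold 𝒜 p q) {U V : Opens M} (h : V ≤ U)
    (f : 𝒜.Sections V) {m : M} (hm : m ∈ V) :
    ∃ (g : 𝒜.Sections U) (W : Opens M) (hW : W ≤ V), m ∈ W ∧
      𝒜.res (hW.trans h) g = 𝒜.res hW f := by
  obtain ⟨χ, W, W', hmW, hWV, hcov, -, h1, h0⟩ := h𝒜.exists_bump hm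
  obtain ⟨g, hg, -⟩ := 𝒜.exists_glue₂ (V' := W' ⊓ U) h inf_le_right
    (fun x hx => (hcov x).imp id fun h => ⟨h, hx⟩) (𝒜.res le_top χ * f) 0
    (fun T hT hT' => by
      rw [map_mul, 𝒜.res_res, ← 𝒜.res_res le_top (hT'.trans inf_le_left), h0, map_zero, zero_mul,
        map_zero])
  refine ⟨g, W, hWV, hmW, ?_⟩
  rw [← 𝒜.res_res h hWV, hg, map_mul, 𝒜.res_res, h1, one_mul]

/-! ### Local operators and their restrictions -/

namespace SuperSheaf

variable (𝒜) in
/-- Operators on `𝒜(U)` that do not enlarge supports. -/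
def IsLocalOp {U : Opens M} (D : Module.End ℝ (𝒜.Sections U)) : Prop :=
  ∀ (W : Opens M) (h : W ≤ U) (f : 𝒜.Sections U), 𝒜.res h f = 0 → 𝒜.res h (D f) = 0

theorem IsLocalOp.res_congr {U : Opens M} {D : Module.End ℝ (𝒜.Sections U)} (hD : 𝒜.IsLocalOp D)
    {W : Opens M} (h : W ≤ U) {f g : 𝒜.Sections U} (hfg : 𝒜.res h f = 𝒜.res h g) :
    𝒜.res h (D f) = 𝒜.res h (D g) := by
  have := hD W h (f - g) (by rw [map_sub, hfg, sub_self])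
  rwa [map_sub, map_sub, sub_eq_zero] at this

theorem IsLocalOp.commutator {U : Opens M} {D : Module.End ℝ (𝒜.Sections U)} (hD : 𝒜.IsLocalOp D)
    (f : 𝒜.Sections U) :
    𝒜.IsLocalOp (D * LinearMap.mulLeft ℝ f - LinearMap.mulLeft ℝ f * D) := by
  intro W h g hg
  simp only [LinearMap.sub_apply, Module.End.mul_apply, LinearMap.mulLeft_apply, map_sub, map_mul]
  rw [hD W h g hg, hD W h (f * g) (by rw [map_mul, hg, mul_zero]), mul_zero, sub_zero]

theorem IsLocalOp.twistedCommutator {U : Opens M} {D : Module.End ℝ (𝒜.Sections U)}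
    (hD : 𝒜.IsLocalOp D) (f : 𝒜.Sections U) :
    𝒜.IsLocalOp (D * LinearMap.mulLeft ℝ f -
      LinearMap.mulLeft ℝ f * twist (𝒜.parityInv U) D) := by
  intro W h g hg
  simp only [LinearMap.sub_apply, Module.End.mul_apply, LinearMap.mulLeft_apply, map_sub, map_mul,
    twist_apply, 𝒜.res_parityInv]
  rw [hD W h (𝒜.parityInv U g) (by rw [𝒜.res_parityInv, hg, map_zero]),
    hD W h (f * g) (by rw [map_mul, hg, mul_zero]), map_zero, mul_zero, sub_zero]

theorem IsRestriction.commutator {U V : Opens M} {h : V ≤ U} {D : Module.End ℝ (𝒜.Sections U)}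
    {D' : Module.End ℝ (𝒜.Sections V)} (hD : 𝒜.IsRestriction h D D') (f : 𝒜.Sections U) :
    𝒜.IsRestriction h (D * LinearMap.mulLeft ℝ f - LinearMap.mulLeft ℝ f * D)
      (D' * LinearMap.mulLeft ℝ (𝒜.res h f) - LinearMap.mulLeft ℝ (𝒜.res h f) * D') := by
  intro g
  simp only [LinearMap.sub_apply, Module.End.mul_apply, LinearMap.mulLeft_apply, map_sub, map_mul,
    hD _]

theorem IsRestriction.twistedCommutator {U V : Opens M} {h : V ≤ U}
    {D : Module.End ℝ (𝒜.Sections U)} {D' : Module.End ℝ (𝒜.Sections V)}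
    (hD : 𝒜.IsRestriction h D D') (f : 𝒜.Sections U) :
    𝒜.IsRestriction h
      (D * LinearMap.mulLeft ℝ f - LinearMap.mulLeft ℝ f * twist (𝒜.parityInv U) D)
      (D' * LinearMap.mulLeft ℝ (𝒜.res h f) -
        LinearMap.mulLeft ℝ (𝒜.res h f) * twist (𝒜.parityInv V) D') := by
  intro g
  simp only [LinearMap.sub_apply, Module.End.mul_apply, LinearMap.mulLeft_apply, map_sub, map_mul,
    twist_apply, hD _, 𝒜.res_parityInv]

theorem IsRestriction.trans {U V W : Opens M} {h : V ≤ U} {h' : W ≤ V}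
    {D : Module.End ℝ (𝒜.Sections U)} {D' : Module.End ℝ (𝒜.Sections V)}
    {D'' : Module.End ℝ (𝒜.Sections W)} (hD : 𝒜.IsRestriction h D D')
    (hD' : 𝒜.IsRestriction h' D' D'') : 𝒜.IsRestriction (h'.trans h) D D'' := by
  intro f
  rw [← 𝒜.res_res h h', hD f, hD', 𝒜.res_res]

end SuperSheaf

/-- Superdifferential operators are local: `D` commutes with an even bump function `χ` up to an
operator of lower order, and `χ f = 0` if `f` vanishes on the support of `χ`. -/
theorem IsSupermanifold.isLocalOp (h𝒜 : IsSupermanifold 𝒜 p q) {U : Opens M} {n : ℕ}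
    {D : Module.End ℝ (𝒜.Sections U)} (hD : IsSuperDiffOp (𝒜.parityInv U) n D) : 𝒜.IsLocalOp D := by
  induction n generalizing D with
  | zero =>
    rw [IsSuperDiffOp] at hD
    intro W h f _
    rw [hD, LinearMap.zero_apply, map_zero]
  | succ n ih =>
    intro W h f hf
    refine 𝒜.eq_of_locally fun m hm => ?_
    obtain ⟨χ, W₁, W', hm₁, hW₁, hcov, hev, h1, h0⟩ := h𝒜.exists_bump hm
    refine ⟨W₁, hW₁, hm₁, ?_⟩
    set χU : 𝒜.Sections U := 𝒜.res le_top χ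
    have hχf : χU * f = 0 := by
      refine 𝒜.eq_of_locally fun x hx => ?_
      rcases hcov x with hxW | hxW'
      · exact ⟨W, h, hxW, by rw [map_mul, hf, mul_zero, map_zero]⟩
      · refine ⟨W' ⊓ U, inf_le_right, ⟨hxW', hx⟩, ?_⟩
        rw [map_mul, 𝒜.res_res, ← 𝒜.res_res le_top (inf_le_left : W' ⊓ U ≤ W'), h0, map_zero,
          zero_mul, map_zero]
    have h2 := ih (hD.1 χU (by rw [← 𝒜.res_parityInv, hev])) W h f hf
    have h3 := congrArg (𝒜.res hW₁) h2
    simp only [LinearMap.sub_apply, Module.End.mul_apply, LinearMap.mulLeft_apply, hχf, map_zero,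
      zero_sub, map_neg, map_mul, neg_eq_zero, 𝒜.res_res, χU, h1, one_mul] at h3
    rw [𝒜.res_res, h3, map_zero]

/-- Two local restrictions of an operator agree, since every germ extends. -/
theorem IsSupermanifold.restriction_unique (h𝒜 : IsSupermanifold 𝒜 p q) {U V : Opens M} (h : V ≤ U)
    {D : Module.End ℝ (𝒜.Sections U)} {D' D'' : Module.End ℝ (𝒜.Sections V)}
    (hl' : 𝒜.IsLocalOp D') (hl'' : 𝒜.IsLocalOp D'')
    (hD' : 𝒜.IsRestriction h D D') (hD'' : 𝒜.IsRestriction h D D'') : D' = D'' := by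
  refine LinearMap.ext fun f => 𝒜.eq_of_locally fun m hm => ?_
  obtain ⟨g, W, hW, hmW, hg⟩ := h𝒜.exists_extension h f hm
  rw [← 𝒜.res_res h hW] at hg
  exact ⟨W, hW, hmW, by rw [← hl'.res_congr hW hg, ← hl''.res_congr hW hg, ← hD', ← hD'']⟩

/-- A local operator on `𝒜(U)` restricts to smaller open sets, by extending germs of sections. -/
theorem IsSupermanifold.exists_restriction (h𝒜 : IsSupermanifold 𝒜 p q) {U V : Opens M} (h : V ≤ U)
    {D : Module.End ℝ (𝒜.Sections U)} (hD : 𝒜.IsLocalOp D) :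
    ∃ D' : Module.End ℝ (𝒜.Sections V), 𝒜.IsLocalOp D' ∧ 𝒜.IsRestriction h D D' := by
  have key : ∀ f : 𝒜.Sections V, ∃ f' : 𝒜.Sections V, ∀ (W : Opens M) (hW : W ≤ V)
      (g : 𝒜.Sections U), 𝒜.res (hW.trans h) g = 𝒜.res hW f →
      𝒜.res hW f' = 𝒜.res (hW.trans h) (D g) := by
    intro f
    choose g W hW hm hg using fun m : V => h𝒜.exists_extension h f m.2
    obtain ⟨f', hf'⟩ := 𝒜.exists_glue W hW (fun m hmV => ⟨⟨m, hmV⟩, hm _⟩)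
      (fun m => 𝒜.res ((hW m).trans h) (D (g m)))
      (fun i j T hi hj => by
        rw [𝒜.res_res, 𝒜.res_res]
        apply hD.res_congr
        rw [← 𝒜.res_res ((hW i).trans h) hi, ← 𝒜.res_res ((hW j).trans h) hj, hg, hg,
          𝒜.res_res, 𝒜.res_res])
    refine ⟨f', fun T hT g' hg' => 𝒜.eq_of_locally fun x hx => ?_⟩
    refine ⟨W ⟨x, hT hx⟩ ⊓ T, inf_le_right, ⟨hm _, hx⟩, ?_⟩
    rw [𝒜.res_res, ← 𝒜.res_res (hW ⟨x, hT hx⟩) inf_le_left, hf', 𝒜.res_res, 𝒜.res_res]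
    apply hD.res_congr
    rw [← 𝒜.res_res ((hW ⟨x, hT hx⟩).trans h) inf_le_left, hg, 𝒜.res_res,
      ← 𝒜.res_res (hT.trans h) inf_le_right, hg', 𝒜.res_res]
  choose Φ hΦ using key
  -- the value on `f` is determined by its defining property
  have huniq : ∀ (f f' : 𝒜.Sections V), (∀ (W : Opens M) (hW : W ≤ V)
      (g : 𝒜.Sections U), 𝒜.res (hW.trans h) g = 𝒜.res hW f →
      𝒜.res hW f' = 𝒜.res (hW.trans h) (D g)) → Φ f = f' := by
    intro f f' hf'
    refine 𝒜.eq_of_locally fun m hm => ?_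
    obtain ⟨g, W, hW, hmW, hg⟩ := h𝒜.exists_extension h f hm
    exact ⟨W, hW, hmW, by rw [hΦ f W hW g hg, hf' W hW g hg]⟩
  refine ⟨⟨⟨Φ, fun f₁ f₂ => ?_⟩, fun r f => ?_⟩, ?_, fun f => ?_⟩
  · refine 𝒜.eq_of_locally fun m hm => ?_
    obtain ⟨g₁, W₁, hW₁, hm₁, hg₁⟩ := h𝒜.exists_extension h f₁ hm
    obtain ⟨g₂, W₂, hW₂, hm₂, hg₂⟩ := h𝒜.exists_extension h f₂ hm
    have e₁ : 𝒜.res ((inf_le_left.trans hW₁ : W₁ ⊓ W₂ ≤ V).trans h) g₁ =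
        𝒜.res (inf_le_left.trans hW₁) f₁ := by
      rw [← 𝒜.res_res (hW₁.trans h) inf_le_left, hg₁, 𝒜.res_res]
    have e₂ : 𝒜.res ((inf_le_left.trans hW₁ : W₁ ⊓ W₂ ≤ V).trans h) g₂ =
        𝒜.res (inf_le_left.trans hW₁) f₂ := by
      rw [← 𝒜.res_res (hW₂.trans h) inf_le_right, hg₂, 𝒜.res_res]
    refine ⟨W₁ ⊓ W₂, inf_le_left.trans hW₁, ⟨hm₁, hm₂⟩, ?_⟩
    rw [map_add, hΦ _ _ _ g₁ e₁, hΦ _ _ _ g₂ e₂,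
      hΦ _ _ _ (g₁ + g₂) (by rw [map_add, map_add, e₁, e₂]), map_add, map_add]
  · refine huniq _ _ fun W hW g hg => ?_
    refine 𝒜.eq_of_locally fun m hm => ?_
    obtain ⟨g', W', hW', hm', hg'⟩ := h𝒜.exists_extension h f (hW hm)
    have e : 𝒜.res ((inf_le_right.trans hW : W' ⊓ W ≤ V).trans h) g' =
        𝒜.res (inf_le_right.trans hW) f := by
      rw [← 𝒜.res_res (hW'.trans h) inf_le_left, hg', 𝒜.res_res]
    refine ⟨W' ⊓ W, inf_le_right, ⟨hm', hm⟩, ?_⟩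
    rw [𝒜.res_res, 𝒜.res_res, RingHom.id_apply, map_smul, hΦ _ _ _ g' e, ← map_smul, ← map_smul]
    apply hD.res_congr
    rw [map_smul, e, ← 𝒜.res_res (hW.trans h) inf_le_right, hg, 𝒜.res_res, map_smul]
  · intro W hW f hf
    change 𝒜.res hW (Φ f) = 0
    rw [hΦ f W hW 0 (by rw [hf, map_zero]), map_zero, map_zero]
  · change _ = Φ (𝒜.res h f)
    have := hΦ (𝒜.res h f) V le_rfl f (𝒜.res_self _).symm
    rw [𝒜.res_self] at this
    exact this.symm

/-- Being a superdifferential operator of bounded order is a local property. -/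
theorem SuperSheaf.IsLocalOp.isSuperDiffOp_of_locally {U : Opens M} {n : ℕ}
    {D : Module.End ℝ (𝒜.Sections U)} (hl : 𝒜.IsLocalOp D)
    (hD : ∀ m ∈ U, ∃ (W : Opens M) (hW : W ≤ U) (D' : Module.End ℝ (𝒜.Sections W)), m ∈ W ∧
      𝒜.IsRestriction hW D D' ∧ IsSuperDiffOp (𝒜.parityInv W) n D') :
    IsSuperDiffOp (𝒜.parityInv U) n D := by
  induction n generalizing D with
  | zero =>
    refine LinearMap.ext fun f => 𝒜.eq_of_locally fun m hm => ?_
    obtain ⟨W, hW, D', hmW, hr, hD'⟩ := hD m hm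
    rw [IsSuperDiffOp] at hD'
    exact ⟨W, hW, hmW, by rw [hr, hD', LinearMap.zero_apply, LinearMap.zero_apply, map_zero]⟩
  | succ n ih =>
    refine ⟨fun f hf => ih (hl.commutator f) fun m hm => ?_,
      fun f hf => ih (hl.twistedCommutator f) fun m hm => ?_⟩
    · obtain ⟨W, hW, D', hmW, hr, hD'⟩ := hD m hm
      exact ⟨W, hW, _, hmW, hr.commutator f, hD'.1 _ (by rw [← 𝒜.res_parityInv, hf])⟩
    · obtain ⟨W, hW, D', hmW, hr, hD'⟩ := hD m hm
      exact ⟨W, hW, _, hmW, hr.twistedCommutator f,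
        hD'.2 _ (by rw [← 𝒜.res_parityInv, hf, map_neg])⟩

/-- Homogeneous germs extend to homogeneous sections. -/
theorem IsSupermanifold.exists_homogeneous_extension (h𝒜 : IsSupermanifold 𝒜 p q)
    {U V : Opens M} (h : V ≤ U) (ε : ℝ) (hε : ε * ε = 1) (f : 𝒜.Sections V)
    (hf : 𝒜.parityInv V f = ε • f) {m : M} (hm : m ∈ V) :
    ∃ (g : 𝒜.Sections U) (W : Opens M) (hW : W ≤ V), m ∈ W ∧ 𝒜.parityInv U g = ε • g ∧
      𝒜.res (hW.trans h) g = 𝒜.res hW f := by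
  obtain ⟨g, W, hW, hmW, hg⟩ := h𝒜.exists_extension h f hm
  refine ⟨(1 / 2 : ℝ) • (g + ε • 𝒜.parityInv U g), W, hW, hmW, ?_, ?_⟩
  · rw [map_smul, map_add, map_smul, (𝒜.isSuperInvolution U).invol, smul_comm ε (1 / 2 : ℝ),
      smul_add ε g, smul_smul ε ε, hε, one_smul, add_comm]
  · rw [map_smul, map_add, map_smul, 𝒜.res_parityInv, hg, ← 𝒜.res_parityInv, hf, map_smul,
      smul_smul, hε, one_smul, ← two_smul ℝ, smul_smul]
    norm_num

/-- Restrictions of superdifferential operators are superdifferential operators of the same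
order. -/
theorem IsSupermanifold.isSuperDiffOp_restriction (h𝒜 : IsSupermanifold 𝒜 p q)
    {U V : Opens M} (h : V ≤ U) {n : ℕ}
    {D : Module.End ℝ (𝒜.Sections U)} {D' : Module.End ℝ (𝒜.Sections V)}
    (hD : IsSuperDiffOp (𝒜.parityInv U) n D) (hl : 𝒜.IsLocalOp D')
    (hr : 𝒜.IsRestriction h D D') : IsSuperDiffOp (𝒜.parityInv V) n D' := by
  induction n generalizing V D D' with
  | zero =>
    rw [IsSuperDiffOp] at hD
    refine h𝒜.restriction_unique h hl (fun W hW f _ => map_zero _) hr fun f => ?_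
    rw [hD, LinearMap.zero_apply, LinearMap.zero_apply, map_zero]
  | succ n ih =>
    refine ⟨fun f hf => (hl.commutator f).isSuperDiffOp_of_locally fun m hm => ?_,
      fun f hf => (hl.twistedCommutator f).isSuperDiffOp_of_locally fun m hm => ?_⟩
    · obtain ⟨g, W, hW, hmW, hev, hg⟩ := h𝒜.exists_homogeneous_extension h 1 (mul_one 1) f
        (by rw [hf, one_smul]) hm
      obtain ⟨D'', hl'', hr''⟩ := h𝒜.exists_restriction hW hl
      refine ⟨W, hW, _, hmW, hr''.commutator f, ?_⟩
      refine ih (hW.trans h) (hD.1 g (by rw [hev, one_smul])) (hl''.commutator _) ?_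
      rw [← hg]
      exact (hr.trans hr'').commutator g
    · obtain ⟨g, W, hW, hmW, hev, hg⟩ := h𝒜.exists_homogeneous_extension h (-1) (by norm_num) f
        (by rw [hf, neg_one_smul]) hm
      obtain ⟨D'', hl'', hr''⟩ := h𝒜.exists_restriction hW hl
      refine ⟨W, hW, _, hmW, hr''.twistedCommutator f, ?_⟩
      refine ih (hW.trans h) (hD.2 g (by rw [hev, neg_one_smul])) (hl''.twistedCommutator _) ?_
      rw [← hg]
      exact (hr.trans hr'').twistedCommutator g

theorem IsSupermanifold.existsUnique_restriction (h𝒜 : IsSupermanifold 𝒜 p q)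
    {U V : Opens M} (h : V ≤ U) {k : ℕ}
    {D : Module.End ℝ (𝒜.Sections U)} (hD : D ∈ 𝒜.diffOp k U) :
    ∃! D' : Module.End ℝ (𝒜.Sections V), D' ∈ 𝒜.diffOp k V ∧ 𝒜.IsRestriction h D D' := by
  rw [𝒜.mem_diffOp_iff] at hD
  obtain ⟨D', hl, hr⟩ := h𝒜.exists_restriction h (h𝒜.isLocalOp hD)
  refine ⟨D', ⟨𝒜.mem_diffOp_iff.2 (h𝒜.isSuperDiffOp_restriction h hD hl hr), hr⟩, ?_⟩
  rintro D'' ⟨hD'', hr''⟩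
  exact h𝒜.restriction_unique h (h𝒜.isLocalOp (𝒜.mem_diffOp_iff.1 hD'')) hl hr'' hr

theorem IsSupermanifold.exists_glue_diffOp (h𝒜 : IsSupermanifold 𝒜 p q) {ι : Type*}
    {U : Opens M} {k : ℕ} (W : ι → Opens M)
    (hW : ∀ i, W i ≤ U) (hcover : ∀ m ∈ U, ∃ i, m ∈ W i)
    (D : ∀ i, Module.End ℝ (𝒜.Sections (W i))) (hD : ∀ i, D i ∈ 𝒜.diffOp k (W i))
    (hs : ∀ i j, ∃ E : Module.End ℝ (𝒜.Sections (W i ⊓ W j)),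
      𝒜.IsRestriction inf_le_left (D i) E ∧ 𝒜.IsRestriction inf_le_right (D j) E) :
    ∃ E ∈ 𝒜.diffOp k U, ∀ i, 𝒜.IsRestriction (hW i) E (D i) := by
  have key : ∀ f : 𝒜.Sections U, ∃ f' : 𝒜.Sections U,
      ∀ i, 𝒜.res (hW i) f' = D i (𝒜.res (hW i) f) := by
    intro f
    refine 𝒜.exists_glue W hW hcover (fun i => D i (𝒜.res (hW i) f)) fun i j T hi hj => ?_
    obtain ⟨E, hEi, hEj⟩ := hs i j
    rw [← 𝒜.res_res inf_le_left (le_inf hi hj), hEi, 𝒜.res_res,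
      ← 𝒜.res_res inf_le_right (le_inf hi hj), hEj, 𝒜.res_res]
  choose Φ hΦ using key
  have huniq : ∀ f f' : 𝒜.Sections U, (∀ i, 𝒜.res (hW i) f = 𝒜.res (hW i) f') → f = f' := by
    intro f f' hf
    refine 𝒜.eq_of_locally fun m hm => ?_
    obtain ⟨i, hi⟩ := hcover m hm
    exact ⟨W i, hW i, hi, hf i⟩
  let E : Module.End ℝ (𝒜.Sections U) :=
    ⟨⟨Φ, fun f g => huniq _ _ fun i => by simp only [map_add, hΦ]⟩,
      fun r f => huniq _ _ fun i => by rw [hΦ, RingHom.id_apply, map_smul, map_smul, map_smul, hΦ]⟩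
  have hE : ∀ i, 𝒜.IsRestriction (hW i) E (D i) := fun i f => hΦ f i
  refine ⟨E, 𝒜.mem_diffOp_iff.2 (SuperSheaf.IsLocalOp.isSuperDiffOp_of_locally ?_
    fun m hm => ?_), hE⟩
  · intro T hT f hf
    refine 𝒜.eq_of_locally fun m hm => ?_
    obtain ⟨i, hi⟩ := hcover m (hT hm)
    refine ⟨W i ⊓ T, inf_le_right, ⟨hi, hm⟩, ?_⟩
    rw [𝒜.res_res, ← 𝒜.res_res (hW i) inf_le_left, hE i, map_zero]
    refine h𝒜.isLocalOp (𝒜.mem_diffOp_iff.1 (hD i)) _ _ _ ?_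
    rw [𝒜.res_res, ← 𝒜.res_res hT inf_le_right, hf, map_zero]
  · obtain ⟨i, hi⟩ := hcover m hm
    exact ⟨W i, hW i, D i, hi, hE i, 𝒜.mem_diffOp_iff.1 (hD i)⟩

/-! ### Partial derivatives in charts -/

/-- The operator `∂_x^α ∂_ξ^β` over an open subset `V` of the domain of a chart. -/
def SuperChart.partialMultiOn {U : Opens M} (c : SuperChart 𝒜 p q U) (V : Opens M) (h : V ≤ U)
    (α : Fin p → ℕ) (β : Fin q → Fin 2) : Module.End ℝ (𝒜.Sections V) :=
  (c.iso V h).symm.toLinearMap ∘ₗ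
    SuperFn.partialMulti q (bodyImage c.toBody V) α β ∘ₗ (c.iso V h).toLinearMap

theorem SuperChart.isRestriction_partialMulti {U : Opens M} (c : SuperChart 𝒜 p q U) (V : Opens M)
    (h : V ≤ U) (α : Fin p → ℕ) (β : Fin q → Fin 2) :
    𝒜.IsRestriction h (c.partialMulti α β) (c.partialMultiOn V h α β) := by
  intro f
  apply (c.iso V h).injective
  rw [c.iso_res U V le_rfl h]
  simp only [SuperChart.partialMulti, SuperChart.partialMultiOn, LinearMap.comp_apply,
    AlgEquiv.toLinearMap_apply, AlgEquiv.apply_symm_apply]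
  rw [c.iso_res U V le_rfl h, SuperFn.partialMulti_res]

theorem SuperChart.exists_basis {U : Opens M} (c : SuperChart 𝒜 p q U) (V : Opens M)
    (h : V ≤ U) (k : ℕ) : ∃ b : Module.Basis (MultiIndex p q k) (𝒜.Sections V) (𝒜.diffOp k V),
      ∀ γ, (b γ : Module.End ℝ (𝒜.Sections V)) = c.partialMultiOn V h γ.1.1 γ.1.2 :=
  exists_basis_partialMulti (𝒜.isSuperInvolution V) (c.iso V h) (c.iso_parityInv V h) k _
    fun _ => 𝒜.mem_diffOp_iff

end Supergeometry

end

noncomputable section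

namespace Supergeometry

/-! ### Sections forming a basis trivialise a sheaf of modules -/

section Free

universe v₁ u₁

variable {C : Type u₁} [Category.{v₁} C] {J : GrothendieckTopology C} {R : Sheaf J RingCat.{u}}
  [HasWeakSheafify J AddCommGrpCat.{u}] [J.WEqualsLocallyBijective AddCommGrpCat.{u}]

/-- If global sections form a basis of the sections over each object, the morphism from the free
sheaf that they define is an isomorphism; the inverse is given by the coordinates in the basis. -/
theorem isIso_freeHomEquiv_symm_of_basis {N : SheafOfModules.{u} R} {I : Type u}
    (s : I → N.sections) (b : ∀ X, Module.Basis I (R.obj.obj X) (N.val.obj X))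
    (hb : ∀ X i, b X i = (s i).eval X) : IsIso (N.freeHomEquiv.symm s) := by
  let φ : ∀ X, N.val.obj X →ₗ[R.obj.obj X] (SheafOfModules.free (R := R) I).val.obj X :=
    fun X => (b X).constr ℕ fun i => (SheafOfModules.freeSection (R := R) i).eval X
  have hφ : ∀ X i, φ X ((s i).eval X) = (SheafOfModules.freeSection (R := R) i).eval X := by
    intro X i
    rw [← hb]
    exact Module.Basis.constr_basis ..
  let j : N ⟶ SheafOfModules.free (R := R) I :=
    { val :=
      { app := fun X => ModuleCat.ofHom (φ X)
        naturality := fun {X Y} f => by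
          refine ModuleCat.hom_ext ((b X).ext fun i => ?_)
          rw [hb]
          refine ((congrArg (φ Y) (PresheafOfModules.sections_property (s i) f)).trans
            (hφ Y i)).trans (Eq.symm ?_)
          exact (congrArg ((SheafOfModules.free (R := R) I).val.map f) (hφ X i)).trans
            (PresheafOfModules.sections_property _ f) } }
  have hj : ∀ i, SheafOfModules.sectionsMap j (s i) = SheafOfModules.freeSection i := fun i =>
    PresheafOfModules.sections_ext _ _ fun X => hφ X i
  refine ⟨j, ?_, ?_⟩
  · apply (SheafOfModules.free I).freeHomEquiv.injective
    funext i
    rw [SheafOfModules.freeHomEquiv_apply, SheafOfModules.sectionsMap_comp,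
      SheafOfModules.sectionsMap_freeHomEquiv_symm_freeSection, hj]
  · refine SheafOfModules.hom_ext (PresheafOfModules.hom_ext fun X =>
      ModuleCat.hom_ext ((b X).ext fun i => ?_))
    have h1 : SheafOfModules.sectionsMap (j ≫ N.freeHomEquiv.symm s) (s i) = s i := by
      rw [SheafOfModules.sectionsMap_comp, hj,
        SheafOfModules.sectionsMap_freeHomEquiv_symm_freeSection]
    rw [hb]
    exact congrArg (fun t : N.sections => t.eval X) h1

end Free

/-! ### The sheaf of superdifferential operators -/

variable {M : TopCat.{u}} {𝒜 : SuperSheaf M} {p q : ℕ}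

namespace IsSupermanifold

variable (h𝒜 : IsSupermanifold 𝒜 p q) (k : ℕ)

/-- The restriction of superdifferential operators to a smaller open set. -/
def restrictDiffOp {U V : Opens M} (h : V ≤ U) (D : 𝒜.diffOp k U) : 𝒜.diffOp k V :=
  ⟨_, (h𝒜.existsUnique_restriction h D.2).choose_spec.1.1⟩

theorem isRestriction_restrictDiffOp {U V : Opens M} (h : V ≤ U) (D : 𝒜.diffOp k U) :
    𝒜.IsRestriction h (D : Module.End ℝ (𝒜.Sections U)) (h𝒜.restrictDiffOp k h D) :=
  (h𝒜.existsUnique_restriction h D.2).choose_spec.1.2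

theorem restrictDiffOp_eq {U V : Opens M} (h : V ≤ U) {D : 𝒜.diffOp k U} {D' : 𝒜.diffOp k V}
    (hD : 𝒜.IsRestriction h (D : Module.End ℝ (𝒜.Sections U)) D') :
    h𝒜.restrictDiffOp k h D = D' :=
  Subtype.ext ((h𝒜.existsUnique_restriction h D.2).unique
    ⟨(h𝒜.restrictDiffOp k h D).2, h𝒜.isRestriction_restrictDiffOp k h D⟩ ⟨D'.2, hD⟩)

theorem restrictDiffOp_smul {U V : Opens M} (h : V ≤ U) (a : 𝒜.Sections U) (D : 𝒜.diffOp k U) :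
    h𝒜.restrictDiffOp k h (a • D) = 𝒜.res h a • h𝒜.restrictDiffOp k h D :=
  h𝒜.restrictDiffOp_eq k h fun g =>
    (map_mul (𝒜.res h) a _).trans (congrArg _ (h𝒜.isRestriction_restrictDiffOp k h D g))

/-- The presheaf of abelian groups `U ↦ 𝒟^k(U)`. -/
def diffOpAb : (Opens M)ᵒᵖ ⥤ AddCommGrpCat.{u} where
  obj U := AddCommGrpCat.of (𝒜.diffOp k U.unop)
  map {U V} f := AddCommGrpCat.ofHom (AddMonoidHom.mk' (h𝒜.restrictDiffOp k f.unop.le)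
    fun D E => h𝒜.restrictDiffOp_eq k _ fun g => by
      have hD := h𝒜.isRestriction_restrictDiffOp k f.unop.le D g
      have hE := h𝒜.isRestriction_restrictDiffOp k f.unop.le E g
      simp only [Submodule.coe_add, LinearMap.add_apply, map_add, hD, hE])
  map_id U := by
    refine AddCommGrpCat.hom_ext (AddMonoidHom.ext fun D => ?_)
    exact h𝒜.restrictDiffOp_eq k _ fun g =>
      (𝒜.res_self _).trans (congrArg _ (𝒜.res_self g).symm)
  map_comp {U V W} f g := by
    refine AddCommGrpCat.hom_ext (AddMonoidHom.ext fun D => ?_)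
    exact h𝒜.restrictDiffOp_eq k _
      (SuperSheaf.IsRestriction.trans (h𝒜.isRestriction_restrictDiffOp k f.unop.le D)
        (h𝒜.isRestriction_restrictDiffOp k g.unop.le _))

instance (U : (Opens M)ᵒᵖ) : Module (𝒜.ringSheaf.obj.obj U) ((h𝒜.diffOpAb k).obj U) :=
  inferInstanceAs (Module (𝒜.Sections U.unop) (𝒜.diffOp k U.unop))

theorem isSheaf_diffOpAb : TopCat.Presheaf.IsSheaf (h𝒜.diffOpAb k) := by
  rw [TopCat.Presheaf.isSheaf_iff_isSheafUniqueGluing]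
  intro ι W D hD
  have hD' : ∀ i j, h𝒜.restrictDiffOp k (inf_le_left : W i ⊓ W j ≤ W i) (D i) =
    h𝒜.restrictDiffOp k (inf_le_right : W i ⊓ W j ≤ W j) (D j) := hD
  obtain ⟨E, hE, hEr⟩ := h𝒜.exists_glue_diffOp (U := iSup W) W (le_iSup W)
    (fun m hm => Opens.mem_iSup.1 hm) (fun i => (D i : 𝒜.diffOp k (W i)).1) (fun i => (D i).2)
    (fun i j => ⟨_, h𝒜.isRestriction_restrictDiffOp k inf_le_left (D i), by
      rw [hD' i j]
      exact h𝒜.isRestriction_restrictDiffOp k inf_le_right (D j)⟩)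
  refine ⟨(⟨E, hE⟩ : 𝒜.diffOp k (iSup W)), fun i => h𝒜.restrictDiffOp_eq k _ (hEr i), ?_⟩
  intro E' hE'
  refine Subtype.ext (LinearMap.ext fun f => 𝒜.eq_of_locally fun m hm => ?_)
  obtain ⟨i, hi⟩ := Opens.mem_iSup.1 hm
  refine ⟨W i, le_iSup W i, hi, ?_⟩
  have h1 : h𝒜.restrictDiffOp k (le_iSup W i) E' = D i := hE' i
  rw [h𝒜.isRestriction_restrictDiffOp k (le_iSup W i) E' f, h1, hEr i f]

/-- The sheaf of `𝒜`-modules `U ↦ 𝒟^k(U)`. -/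
def diffOpSheaf : SheafOfModules.{u} 𝒜.ringSheaf where
  val := PresheafOfModules.ofPresheaf (h𝒜.diffOpAb k) fun _ _ f a D => 
    h𝒜.restrictDiffOp_smul k f.unop.le a D
  isSheaf := h𝒜.isSheaf_diffOpAb k

/-- The sections of `diffOpSheaf` over `U` are by definition the elements of `𝒟^k(U)`. -/
def sectionsEquiv (U : Opens M) :
    𝒜.ModSections (h𝒜.diffOpSheaf k) U ≃ₗ[𝒜.Sections U] 𝒜.diffOp k U :=
  LinearEquiv.refl (𝒜.Sections U) (𝒜.diffOp k U)

theorem isRestriction_modRes {U V : Opens M} (h : V ≤ U)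
    (s : 𝒜.ModSections (h𝒜.diffOpSheaf k) U) :
    𝒜.IsRestriction h (h𝒜.sectionsEquiv k U s : Module.End ℝ (𝒜.Sections U))
      (h𝒜.sectionsEquiv k V (𝒜.modRes (h𝒜.diffOpSheaf k) h s)) :=
  h𝒜.isRestriction_restrictDiffOp k h s

theorem partialMulti_mem_diffOp {U : Opens M} (c : SuperChart 𝒜 p q U) (γ : MultiIndex p q k) :
    c.partialMulti γ.1.1 γ.1.2 ∈ 𝒜.diffOp k U := by
  obtain ⟨b, hb⟩ := c.exists_basis U le_rfl k
  have := (b γ).2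
  rwa [hb] at this

/-- The operators `∂_x^α ∂_ξ^β` as sections of the sheaf of superdifferential operators. -/
def partialSection {U : Opens M} (c : SuperChart 𝒜 p q U) (γ : MultiIndex p q k) :
    𝒜.ModSections (h𝒜.diffOpSheaf k) U :=
  (h𝒜.sectionsEquiv k U).symm ⟨_, partialMulti_mem_diffOp k c γ⟩

theorem isBasisOn_partialSection {U : Opens M} (c : SuperChart 𝒜 p q U) :
    𝒜.IsBasisOn (h𝒜.diffOpSheaf k) U (h𝒜.partialSection k c) := by
  intro V h
  obtain ⟨b, hb⟩ := c.exists_basis V h k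
  refine ⟨b.map (h𝒜.sectionsEquiv k V).symm, fun γ => ?_⟩
  refine (h𝒜.restrictDiffOp_eq k h (D := ⟨_, partialMulti_mem_diffOp k c γ⟩) (D' := b γ) ?_).symm
  rw [hb]
  exact c.isRestriction_partialMulti V h _ _

/-- The operators `∂_x^α ∂_ξ^β` of a chart on `U` as global sections of the restriction to `U` of
the sheaf of superdifferential operators. -/
def partialOverSection {U : Opens M} (c : SuperChart 𝒜 p q U) (γ : MultiIndex p q k) :
    ((h𝒜.diffOpSheaf k).over U).sections :=
  PresheafOfModules.sectionsMk (M := ((h𝒜.diffOpSheaf k).over U).val)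
    (fun X => (𝒜.modRes (h𝒜.diffOpSheaf k) (leOfHom X.unop.hom) (h𝒜.partialSection k c γ) :))
    fun X Y f => by
      exact (h𝒜.restrictDiffOp_eq k (leOfHom Y.unop.hom)
        (SuperSheaf.IsRestriction.trans
          (h𝒜.isRestriction_restrictDiffOp k (leOfHom X.unop.hom) _)
          (h𝒜.isRestriction_restrictDiffOp k (leOfHom f.unop.left) _))).symm

/-- The restrictions of the operators `∂_x^α ∂_ξ^β` as a basis of the sections over an open subset
of the domain of a chart. -/
def overBasis {U : Opens M} (c : SuperChart 𝒜 p q U) (X : (Over U)ᵒᵖ) :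
    Module.Basis (ULift.{u} (MultiIndex p q k)) ((𝒜.ringSheaf.over U).obj.obj X)
      (((h𝒜.diffOpSheaf k).over U).val.obj X) :=
  let b := ((h𝒜.isBasisOn_partialSection k c X.unop.left (leOfHom X.unop.hom)).choose).reindex
    Equiv.ulift.{u}.symm
  Module.Basis.ofRepr
    { toFun := b.repr
      invFun := b.repr.symm
      left_inv := b.repr.left_inv
      right_inv := b.repr.right_inv
      map_add' := b.repr.map_add
      map_smul' := b.repr.map_smul }

theorem overBasis_apply {U : Opens M} (c : SuperChart 𝒜 p q U) (X : (Over U)ᵒᵖ)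
    (γ : ULift.{u} (MultiIndex p q k)) :
    h𝒜.overBasis k c X γ = (h𝒜.partialOverSection k c γ.down).eval X :=
  (Module.Basis.reindex_apply _ _ _).trans
    ((h𝒜.isBasisOn_partialSection k c X.unop.left (leOfHom X.unop.hom)).choose_spec _)

theorem isIso_partialOverSection {U : Opens M} (c : SuperChart 𝒜 p q U) :
    IsIso (((h𝒜.diffOpSheaf k).over U).freeHomEquiv.symm
      fun γ : ULift.{u} (MultiIndex p q k) => h𝒜.partialOverSection k c γ.down) :=
  isIso_freeHomEquiv_symm_of_basis _ (h𝒜.overBasis k c) (h𝒜.overBasis_apply k c)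

theorem isLocallyFree_diffOpSheaf : (h𝒜.diffOpSheaf k).IsLocallyFree := by
  choose U hU c using h𝒜.exists_chart
  let G : SheafOfModules.LocalGeneratorsData.{u} (h𝒜.diffOpSheaf k) :=
    { I := M
      X := U
      coversTop := fun W m hm =>
        ⟨W ⊓ U m, homOfLE inf_le_left, ⟨m, ⟨homOfLE inf_le_right⟩⟩, hm, hU m⟩
      generators := fun m =>
        { I := ULift.{u} (MultiIndex p q k)
          s := fun γ => h𝒜.partialOverSection k (c m).some γ.down
          epi := by
            have := h𝒜.isIso_partialOverSection k (c m).some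
            infer_instance } }
  have hG : G.IsLocallyFreeData :=
    SheafOfModules.LocalGeneratorsData.IsLocallyFreeData.mk (q := G)
      fun m => h𝒜.isIso_partialOverSection k (c m).some
  exact SheafOfModules.IsLocallyFree.mk.{u, u, u} ⟨G, hG⟩

end IsSupermanifold

end Supergeometry

end

theorem mainTheorem10 {M : TopCat.{u}} (𝒜 : Supergeometry.SuperSheaf M) (p q : ℕ)
    (h𝒜 : Supergeometry.IsSupermanifold 𝒜 p q) (k : ℕ) :
    -- `k`-th order operators restrict uniquely to smaller open sets
    (∀ (U V : Opens M) (h : V ≤ U), ∀ D ∈ 𝒜.diffOp k U,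
      ∃! D' : Module.End ℝ (𝒜.Sections V), D' ∈ 𝒜.diffOp k V ∧ 𝒜.IsRestriction h D D') ∧
    -- with these restrictions they form a sheaf of `𝒜`-modules
    ∃ (𝒟 : SheafOfModules.{u} 𝒜.ringSheaf)
      (ι : ∀ U : Opens M, 𝒜.ModSections 𝒟 U ≃ₗ[𝒜.Sections U] 𝒜.diffOp k U),
      (∀ (U V : Opens M) (h : V ≤ U) (s : 𝒜.ModSections 𝒟 U),
        𝒜.IsRestriction h (ι U s : Module.End ℝ (𝒜.Sections U)) (ι V (𝒜.modRes 𝒟 h s))) ∧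
      -- which is locally free,
      𝒟.IsLocallyFree ∧
      -- with the stated basis in all local coordinates
      ∀ (U : Opens M) (c : Supergeometry.SuperChart 𝒜 p q U),
        ∃ e : Supergeometry.MultiIndex p q k → 𝒜.ModSections 𝒟 U,
          (∀ γ, (ι U (e γ) : Module.End ℝ (𝒜.Sections U)) = c.partialMulti γ.1.1 γ.1.2) ∧
          𝒜.IsBasisOn 𝒟 U e :=
  ⟨fun _ _ h _ hD => h𝒜.existsUnique_restriction h hD, h𝒜.diffOpSheaf k, h𝒜.sectionsEquiv k,
    fun _ _ h s => h𝒜.isRestriction_modRes k h s, h𝒜.isLocallyFree_diffOpSheaf k,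
    fun _ c => ⟨h𝒜.partialSection k c, fun _ => rfl, h𝒜.isBasisOn_partialSection k c⟩⟩
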